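/- Theorem. Throughout, $L^2=L^2(0,1)$ is complex, with inner product $\langle\cdot,\cdot\rangle$, and $L^\infty=L^\infty(0,1)$ is real. For $q\in L^\infty$ let $\mathcal L y=-y''+qy$ be the Sturm--Liouville operator on $(0,1)$ with Dirichlet conditions $y(0)=y(1)=0$; its domain consists of those $y\in C^1[0,1]$ with $y'$ absolutely continuous, $y(0)=y(1)=0$ and $\mathcal L y\in L^2$. For $r\ge 0$ the power $\mathcal L^{r}$ is the operator with the same eigenfunctions as $\mathcal L$ and the eigenvalues $\lambda^{r}$ ($\lambda$ an eigenvalue of $\mathcal L$): $f\in L^2$ is in its domain with $\mathcal L^{r}f=g\in L^2$ iff $\langle g,\varphi\rangle=\lambda^{r}\langle f,\varphi\rangle$ for every eigenfunction $\varphi$ of $\mathcal L$ with eigenvalue $\lambda$ (with $\lambda^0=1$). For $s\ge0$ put $W^s_{\mathcal L}=\{f\in L^2:\mathcal L^{s/2}f\in L^2\}$ and $\|f\|_{W^s_{\mathcal L}}=\|\mathcal L^{s/2}f\|_{L^2}$. Let $T>0$, $s\ge 0$ and $\delta>0$. There is a constant $C>0$, depending only on $T,s,\delta$, such that the following holds.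 Let $q\in L^\infty$ be real and, if $s>0$, assume that all eigenvalues of $\mathcal L$ are $\ge\delta$. Let $a,b\in L^\infty$ be non-negative, and let $u_0\in W^s_{\mathcal L}$, $u_1\in L^2$. Then the problem $$u_{tt}+\mathcal L^su+a(x)u+b(x)u_t=0\ \text{ on }[0,T]\times(0,1),\qquad u(0,\cdot)=u_0,\quad u_t(0,\cdot)=u_1,\qquad u(t,0)=u(t,1)=0,$$ has a unique solution $u\in C([0,T];W^s_{\mathcal L})\cap C^1([0,T];L^2)$, and for all $t\in[0,T]$ each of $$\|u(t,\cdot)\|_{L^2},\qquad \|\mathcal L^{s/2}u(t,\cdot)\|_{L^2},\qquad \|u_t(t,\cdot)\|_{L^2}$$ is at most $$C\,(1+\|a\|_{L^\infty}+\|b\|_{L^\infty})\,\big(\|u_0\|_{W^s_{\mathcal L}}+\|u_1\|_{L^2}\big).$$ Here the equation is understood weakly: for every $v\in W^s_{\mathcal L}$ the function $t\mapsto\langle u_t(t),v\rangle$ is differentiable on $[0,T]$ and $$\frac{d}{dt}\langle u_t(t),v\rangle+\langle\mathcal L^{s/2}u(t),\mathcal L^{s/2}v\rangle+\langle a\,u(t),v\rangle+\langle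 b\,u_t(t),v\rangle=0 .$$ The Dirichlet conditions are those built into $\mathcal L$; when $s>1/2$ they moreover hold pointwise: for every $t$, $u(t,\cdot)$ has a continuous representative on $[0,1]$ that vanishes at $0$ and $1$. -/

import Mathlib

open MeasureTheory Set
open scoped ENNReal InnerProductSpace

noncomputable section

namespace SturmLiouville

/-- Lebesgue measure on the interval `(0,1)`. -/
abbrev vol : Measure ℝ := volume.restrict (Ioo (0 : ℝ) 1)

/-- The complex Hilbert space `L²(0,1)`. -/
abbrev L2 : Type := Lp ℂ 2 vol

/-- The space `L^∞(0,1)` of real-valued functions. -/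
abbrev LInf : Type := Lp ℝ ∞ vol

/-- The Dirichlet Sturm–Liouville operator `𝓛 = -d²/dx² + q`, as a relation on `L²(0,1)`:
`f` lies in the domain of `𝓛` and `𝓛 f = g`. That is, `f` has a representative `y` that is `C¹` on
`[0,1]`, vanishes at `0` and `1`, and whose derivative `p` is absolutely continuous with
`p' = q f - g` almost everywhere (so `-y'' + q y = g`). -/
def IsOp (q : LInf) (f g : L2) : Prop :=
  ∃ y p : ℝ → ℂ,
    (f =ᵐ[vol] y) ∧ y 0 = 0 ∧ y 1 = 0 ∧
    (∀ x ∈ Icc (0 : ℝ) 1, HasDerivWithinAt y (p x) (Icc 0 1) x) ∧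
    (∀ x ∈ Icc (0 : ℝ) 1, p x = p 0 + ∫ t in (0 : ℝ)..x, ((q t : ℂ) * f t - g t))

/-- `φ` is an eigenfunction of the Dirichlet Sturm–Liouville operator with eigenvalue `ev`. -/
def IsEigenpair (q : LInf) (ev : ℝ) (φ : L2) : Prop :=
  φ ≠ 0 ∧ IsOp q φ ((ev : ℂ) • φ)

/-- `ev` is an eigenvalue of the Dirichlet Sturm–Liouville operator. -/
def IsEigenvalue (q : LInf) (ev : ℝ) : Prop :=
  ∃ φ : L2, IsEigenpair q ev φ

/-- `f` lies in the domain of the power `𝓛^r` and `𝓛^r f = g`: the coefficient of `g` along every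
eigenfunction of `𝓛` is that of `f` multiplied by the `r`-th power of the eigenvalue. -/
def IsFracPow (q : LInf) (r : ℝ) (f g : L2) : Prop :=
  ∀ (ev : ℝ) (φ : L2), IsEigenpair q ev φ → ⟪φ, g⟫_ℂ = ((ev ^ r : ℝ) : ℂ) * ⟪φ, f⟫_ℂ

/-- Membership in the Sobolev space `W^s_𝓛 = {f ∈ L² : 𝓛^{s/2} f ∈ L²}`, for `s ≥ 0`. -/
def MemSobolev (q : LInf) (s : ℝ) (f : L2) : Prop :=
  ∃ g : L2, IsFracPow q (s / 2) f g

open Classical in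
/-- The function `𝓛^r f ∈ L²(0,1)` (equal to `0` if `f` is not in the domain of `𝓛^r`). -/
def fracPow (q : LInf) (r : ℝ) (f : L2) : L2 :=
  if h : ∃ g : L2, IsFracPow q r f g then h.choose else 0

/-- The norm `‖𝓛^{s/2} f‖_{L²}` of `W^s_𝓛`. -/
def sobolevNorm (q : LInf) (s : ℝ) (f : L2) : ℝ := ‖fracPow q (s / 2) f‖

/-- The time derivative `u_t` on `[0,T]` (one-sided at the endpoints) of a curve in `L²(0,1)`. -/
def timeDeriv (T : ℝ) (u : ℝ → L2) (t : ℝ) : L2 := derivWithin u (Icc 0 T) t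

/-- `u ∈ C([0,T]; W^s_𝓛) ∩ C¹([0,T]; L²)` is a solution of
`u_tt + 𝓛^s u + a u + b u_t = 0`, `u(0) = u₀`, `u_t(0) = u₁`, `u(t,0) = u(t,1) = 0`.
The equation is tested with arbitrary elements of `W^s_𝓛`. The Dirichlet conditions are part of
the operator `𝓛`; in the range `s > 1/2`, where elements of `W^s_𝓛` have boundary values, they
are also required pointwise for the continuous representative of `u(t)`. -/
structure IsSolution (T s : ℝ) (q a b : LInf) (u₀ u₁ : L2) (u : ℝ → L2) : Prop where
  mem_sobolev : ∀ t ∈ Icc 0 T, MemSobolev q s (u t)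
  continuousOn_sobolev : ContinuousOn (fun t => fracPow q (s / 2) (u t)) (Icc 0 T)
  contDiffOn : ContDiffOn ℝ 1 u (Icc 0 T)
  equation : ∀ v : L2, MemSobolev q s v → ∀ t ∈ Icc 0 T,
    HasDerivWithinAt (fun τ => ⟪v, timeDeriv T u τ⟫_ℂ)
      (-(⟪fracPow q (s / 2) v, fracPow q (s / 2) (u t)⟫_ℂ
        + ⟪v, (a • u t : L2)⟫_ℂ + ⟪v, (b • timeDeriv T u t : L2)⟫_ℂ)) (Icc 0 T) t
  initial : u 0 = u₀
  initial_deriv : timeDeriv T u 0 = u₁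
  boundary : 1 / 2 < s → ∀ t ∈ Icc 0 T, ∃ y : ℝ → ℂ,
    ContinuousOn y (Icc 0 1) ∧ y 0 = 0 ∧ y 1 = 0 ∧ u t =ᵐ[vol] y

end SturmLiouville

end

/-! The Dirichlet operator has an eigenfunction Hilbert basis `e n`, so `𝓛^{s/2}` becomes a diagonal
operator `A` with eigenvalues `μ n = ev n ^ (s / 2)`, bounded below by `δ ^ (s / 2) > 0` (by `1` if
`s = 0`). The problem is then the abstract equation `u'' + A²u + Pu + Qu' = 0` with `P`, `Q`
bounded, `P` symmetric and both non-negative.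

Set `w = Au`, `z = u'`. In general neither is differentiable in the Hilbert space, but the profiles
`e^{∓itA}(z ± iw)` are: their derivative is `-e^{∓itA}(Pu + Qz)`, from which the unbounded part has
disappeared. Since `u = A⁻¹w`, the profiles satisfy a linear ODE with bounded, strongly continuous
coefficients, solved by Picard iteration (`exists_linear_ode_solution`, `exists_isModalSolution`).
As `e^{itA}` is unitary, half the sum of the squared norms of the profiles is `‖z‖² + ‖w‖²`; adding
`⟨u, Pu⟩` gives an energy that decreases because `Q ≥ 0` (`energy_le`). This yields both uniqueness
and the estimates.

The eigenbasis (`exists_eigenbasis`) comes from the spectral theorem for a compact symmetric inverse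
of `𝓛 + c`, assembled from the Volterra operator. The boundary values for `s > 1/2`
(`exists_continuous_rep`) come from a sup-norm estimate on finite sums of eigenfunctions, applied on
dyadic ranges of eigenvalues and summed geometrically. -/

noncomputable section

namespace SturmLiouville

open scoped BoundedContinuousFunction

/-! ### Linear ODEs in Banach spaces. -/

section LinearODE

variable {X : Type*} [NormedAddCommGroup X] [NormedSpace ℝ X]

/-- A uniformly bounded, strongly continuous family of operators applied to a continuous curve. -/
lemma continuousOn_apply_of_strong {α Y Z : Type*} [TopologicalSpace α] [NormedAddCommGroup Y]
    [NormedAddCommGroup Z] (F : α → Y → Z) (K : ℝ)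
    (hK : ∀ t x y, ‖F t x - F t y‖ ≤ K * ‖x - y‖) (hF : ∀ x, Continuous fun t => F t x)
    {g : α → Y} {S : Set α} (hg : ContinuousOn g S) : ContinuousOn (fun t => F t (g t)) S := by
  intro t ht
  rw [ContinuousWithinAt, tendsto_iff_norm_sub_tendsto_zero]
  have h1 : Filter.Tendsto (fun τ => K * ‖g τ - g t‖ + ‖F τ (g t) - F t (g t)‖)
      (nhdsWithin t S) (nhds (K * 0 + 0)) := by
    refine Filter.Tendsto.add (Filter.Tendsto.const_mul _ ?_) ?_
    · exact tendsto_iff_norm_sub_tendsto_zero.1 (hg t ht)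
    · exact tendsto_iff_norm_sub_tendsto_zero.1
        ((hF (g t)).continuousAt.tendsto.mono_left nhdsWithin_le_nhds)
  rw [mul_zero, add_zero] at h1
  refine squeeze_zero (fun _ => norm_nonneg _) (fun τ => ?_) h1
  calc ‖F τ (g τ) - F t (g t)‖ = ‖(F τ (g τ) - F τ (g t)) + (F τ (g t) - F t (g t))‖ := by abel_nf
    _ ≤ _ := (norm_add_le _ _).trans (by gcongr; exact hK _ _ _)

/-- Global solvability of a linear ODE with bounded, strongly continuous coefficients. -/
theorem exists_linear_ode_solution [CompleteSpace X] (F : ℝ → X →L[ℝ] X) (K : ℝ)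
    (hK : ∀ t, ‖F t‖ ≤ K) (hF : ∀ x, Continuous fun t => F t x) (x₀ : X) {T : ℝ} (hT : 0 ≤ T) :
    ∃ Y : ℝ → X, Y 0 = x₀ ∧ ∀ t ∈ Icc 0 T, HasDerivAt Y (F t (Y t)) t := by
  have hK0 : 0 ≤ K := (norm_nonneg _).trans (hK 0)
  set γ : ℝ := 2 * K + 1 with hγ
  have hγ0 : 0 < γ := by positivity
  have hFL : ∀ t x y, ‖F t x - F t y‖ ≤ K * ‖x - y‖ := fun t x y => by
    rw [← map_sub]; exact (F t).le_of_opNorm_le (hK t) _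
  -- The unknown `z` is `e^{-γt} Y(t)`. This weight makes the Picard map a contraction on all of
  -- `[0,T]` at once, with factor `K / γ ≤ 1/2`.
  let I : C(Icc (0 : ℝ) T, X) → ℝ → X := fun z τ => Real.exp (γ * τ) • F τ (z (projIcc 0 T hT τ))
  have hI : ∀ z, Continuous (I z) := fun z => by
    refine (by fun_prop : Continuous fun τ : ℝ => Real.exp (γ * τ)).smul ?_
    rw [← continuousOn_univ]
    exact continuousOn_apply_of_strong (fun t x => F t x) K hFL hF
      (z.continuous.comp continuous_projIcc).continuousOn
  have hprim : ∀ z t, HasDerivAt (fun t => x₀ + ∫ τ in (0 : ℝ)..t, I z τ) (I z t) t := fun z t =>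
    (intervalIntegral.integral_hasDerivAt_right ((hI z).intervalIntegrable _ _)
      ((hI z).stronglyMeasurableAtFilter _ _) (hI z).continuousAt).const_add _
  let Φ : C(Icc (0 : ℝ) T, X) → C(Icc (0 : ℝ) T, X) := fun z =>
    ⟨fun t => Real.exp (-(γ * t)) • (x₀ + ∫ τ in (0 : ℝ)..t, I z τ), by
      have : Continuous fun t => x₀ + ∫ τ in (0 : ℝ)..t, I z τ :=
        continuous_iff_continuousAt.2 fun t => (hprim z t).continuousAt
      exact (by fun_prop : Continuous fun t : Icc (0 : ℝ) T => Real.exp (-(γ * (t : ℝ)))).smul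
        (this.comp continuous_subtype_val)⟩
  have hΦ : ContractingWith (1 / 2) Φ := by
    refine ⟨by rw [← NNReal.coe_lt_coe]; norm_num, LipschitzWith.of_dist_le_mul fun z₁ z₂ => ?_⟩
    rw [ContinuousMap.dist_le (by positivity)]
    rintro ⟨t, ht⟩
    have e1 : Φ z₁ ⟨t, ht⟩ - Φ z₂ ⟨t, ht⟩
        = Real.exp (-(γ * t)) • ∫ τ in (0 : ℝ)..t, (I z₁ τ - I z₂ τ) := by
      rw [intervalIntegral.integral_sub ((hI _).intervalIntegrable _ _)
        ((hI _).intervalIntegrable _ _)]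
      simp only [Φ, ContinuousMap.coe_mk, ← smul_sub]
      congr 1; abel
    have e2 : ∀ τ, ‖I z₁ τ - I z₂ τ‖ ≤ Real.exp (γ * τ) * (K * dist z₁ z₂) := fun τ => by
      simp only [I, ← smul_sub]
      rw [norm_smul, Real.norm_of_nonneg (Real.exp_pos _).le]
      gcongr
      refine (hFL _ _ _).trans ?_
      gcongr
      rw [← dist_eq_norm]
      exact ContinuousMap.dist_apply_le_dist _
    have e3 : ‖∫ τ in (0 : ℝ)..t, (I z₁ τ - I z₂ τ)‖
        ≤ ∫ τ in (0 : ℝ)..t, Real.exp (γ * τ) * (K * dist z₁ z₂) :=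
      intervalIntegral.norm_integral_le_of_norm_le ht.1 (Filter.Eventually.of_forall fun τ _ => e2 τ)
        (Continuous.intervalIntegrable (by fun_prop) _ _)
    have e4 : ∫ τ in (0 : ℝ)..t, Real.exp (γ * τ) * (K * dist z₁ z₂)
        = (Real.exp (γ * t) - 1) / γ * (K * dist z₁ z₂) := by
      rw [intervalIntegral.integral_mul_const,
        intervalIntegral.integral_comp_mul_left (fun x => Real.exp x) hγ0.ne', integral_exp]
      simp [div_eq_inv_mul]
    rw [dist_eq_norm, e1, norm_smul, Real.norm_of_nonneg (Real.exp_pos _).le]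
    have hd : 0 ≤ dist z₁ z₂ := dist_nonneg
    calc Real.exp (-(γ * t)) * ‖∫ τ in (0 : ℝ)..t, (I z₁ τ - I z₂ τ)‖
        ≤ Real.exp (-(γ * t)) * ((Real.exp (γ * t) - 1) / γ * (K * dist z₁ z₂)) := by
          gcongr; exact e3.trans_eq e4
      _ = (1 - Real.exp (-(γ * t))) * (K / γ) * dist z₁ z₂ := by
          have : Real.exp (-(γ * t)) * Real.exp (γ * t) = 1 := by rw [← Real.exp_add]; simp
          field_simp
          linear_combination (dist z₁ z₂) * K * this
      _ ≤ 1 * (1 / 2) * dist z₁ z₂ := by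
          have h1 : K / γ ≤ 1 / 2 := by
            rw [div_le_div_iff₀ hγ0 (by norm_num)]; rw [hγ]; linarith
          have h2 : 1 - Real.exp (-(γ * t)) ≤ 1 := by linarith [Real.exp_pos (-(γ * t))]
          gcongr
      _ = _ := by simp
  obtain ⟨z, hz⟩ : ∃ z, Φ z = z := ⟨_, hΦ.fixedPoint_isFixedPt⟩
  refine ⟨fun t => x₀ + ∫ τ in (0 : ℝ)..t, I z τ, by simp, fun t ht => ?_⟩
  convert hprim z t using 1
  have h1 : z ⟨t, ht⟩ = Real.exp (-(γ * t)) • (x₀ + ∫ τ in (0 : ℝ)..t, I z τ) := by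
    conv_lhs => rw [← hz]
    rfl
  simp only [I, projIcc_of_mem hT ht]
  rw [h1, map_smul, smul_smul, ← Real.exp_add]
  simp only [add_neg_cancel, Real.exp_zero, one_smul]
  rfl

end LinearODE

/-! ### Diagonal operators and the unitary group in a Hilbert basis. -/

section Diagonal

variable {ι H : Type*} [NormedAddCommGroup H] [InnerProductSpace ℂ H]
  (b : HilbertBasis ι ℂ H)

lemma hasSum_norm_inner_sq (f : H) : HasSum (fun n => ‖⟪b n, f⟫_ℂ‖ ^ 2) (‖f‖ ^ 2) := by
  have h := b.hasSum_inner_mul_inner f f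
  have h2 := (Complex.reCLM.hasSum h)
  convert h2 using 1
  · ext n
    rw [← inner_conj_symm f (b n), ← Complex.normSq_eq_conj_mul_self]
    rw [Complex.normSq_eq_norm_sq, Complex.reCLM_apply, Complex.ofReal_re]
  · simpa using (inner_self_eq_norm_sq (𝕜 := ℂ) f).symm

variable {b} in
lemma basis_ext {f g : H} (h : ∀ n, ⟪b n, f⟫_ℂ = ⟪b n, g⟫_ℂ) : f = g := by
  apply b.repr.injective
  ext n
  simpa [b.repr_apply_apply] using h n

lemma exists_of_summable {c : ι → ℂ} (hc : Summable fun n => ‖c n‖ ^ 2) :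
    ∃ g : H, ∀ n, ⟪b n, g⟫_ℂ = c n := by
  have hm : Memℓp c 2 := by
    refine memℓp_gen ?_
    simpa using hc
  exact ⟨b.repr.symm ⟨c, hm⟩, fun n => by simp [← b.repr_apply_apply]⟩

lemma exists_diag {σ : ι → ℂ} {C : ℝ} (hσ : ∀ n, ‖σ n‖ ≤ C) (f : H) :
    ∃ g : H, ∀ n, ⟪b n, g⟫_ℂ = σ n * ⟪b n, f⟫_ℂ := by
  refine exists_of_summable b (Summable.of_nonneg_of_le (fun _ => by positivity) (fun n => ?_)
    ((hasSum_norm_inner_sq b f).summable.mul_left (C ^ 2)))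
  rw [norm_mul, mul_pow]
  gcongr
  exact hσ n

lemma norm_le_of_coeff_le {f g : H} {C : ℝ} (hC : 0 ≤ C)
    (h : ∀ n, ‖⟪b n, g⟫_ℂ‖ ≤ C * ‖⟪b n, f⟫_ℂ‖) : ‖g‖ ≤ C * ‖f‖ := by
  rw [← sq_le_sq₀ (norm_nonneg _) (by positivity), mul_pow]
  refine hasSum_le (fun n => ?_) (hasSum_norm_inner_sq b g)
    ((hasSum_norm_inner_sq b f).mul_left (C ^ 2))
  rw [← mul_pow]
  gcongr
  exact h n

/-- The operator that is diagonal in the basis `b`, with bounded multipliers `σ`. -/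
def diag (σ : ι → ℂ) (C : ℝ) (hσ : ∀ n, ‖σ n‖ ≤ C) : H →L[ℂ] H :=
  LinearMap.mkContinuous
    { toFun := fun f => (exists_diag b hσ f).choose
      map_add' := fun f g => basis_ext (b := b) fun n => by
        rw [inner_add_right, (exists_diag b hσ (f + g)).choose_spec,
          (exists_diag b hσ f).choose_spec, (exists_diag b hσ g).choose_spec, inner_add_right]
        ring
      map_smul' := fun c f => basis_ext (b := b) fun n => by
        rw [RingHom.id_apply, inner_smul_right, (exists_diag b hσ (c • f)).choose_spec,
          (exists_diag b hσ f).choose_spec, inner_smul_right]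
        ring }
    (max C 0) (fun f => norm_le_of_coeff_le b (le_max_right _ _) fun n => by
      simp only [LinearMap.coe_mk, AddHom.coe_mk, (exists_diag b hσ f).choose_spec, norm_mul]
      gcongr
      exact (hσ n).trans (le_max_left _ _))

lemma inner_diag {σ : ι → ℂ} {C : ℝ} (hσ : ∀ n, ‖σ n‖ ≤ C) (f : H) (n : ι) :
    ⟪b n, diag b σ C hσ f⟫_ℂ = σ n * ⟪b n, f⟫_ℂ :=
  (exists_diag b hσ f).choose_spec n

variable (μ : ι → ℝ)

/-- The unitary group `e^{itA}`, where `A` is diagonal in the basis `b` with eigenvalues `μ`. -/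
def expGroup (t : ℝ) : H →L[ℂ] H :=
  diag b (fun n => Complex.exp ((t * μ n : ℝ) * Complex.I)) 1
    (fun _ => (Complex.norm_exp_ofReal_mul_I _).le)

lemma inner_expGroup (t : ℝ) (f : H) (n : ι) :
    ⟪b n, expGroup b μ t f⟫_ℂ = Complex.exp ((t * μ n : ℝ) * Complex.I) * ⟪b n, f⟫_ℂ :=
  inner_diag b _ f n

lemma norm_expGroup_apply (t : ℝ) (f : H) : ‖expGroup b μ t f‖ = ‖f‖ := by
  have h1 := hasSum_norm_inner_sq b (expGroup b μ t f)
  simp only [inner_expGroup, norm_mul, Complex.norm_exp_ofReal_mul_I, one_mul] at h1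
  have h2 := h1.unique (hasSum_norm_inner_sq b f)
  exact (sq_eq_sq₀ (norm_nonneg _) (norm_nonneg _)).1 h2

lemma expGroup_neg_apply (t : ℝ) (f : H) : expGroup b μ (-t) (expGroup b μ t f) = f :=
  basis_ext (b := b) fun n => by
    rw [inner_expGroup, inner_expGroup, ← mul_assoc, ← Complex.exp_add, ← add_mul,
      ← Complex.ofReal_add]
    simp

lemma expGroup_apply_neg (t : ℝ) (f : H) : expGroup b μ t (expGroup b μ (-t) f) = f := by
  simpa using expGroup_neg_apply b μ (-t) f

lemma expGroup_zero (f : H) : expGroup b μ 0 f = f :=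
  basis_ext (b := b) fun n => by simp [inner_expGroup]

lemma inner_expGroup_left (t : ℝ) (f g : H) :
    ⟪expGroup b μ t f, expGroup b μ t g⟫_ℂ = ⟪f, g⟫_ℂ := by
  refine (b.hasSum_inner_mul_inner _ _).unique ?_
  convert b.hasSum_inner_mul_inner f g using 2 with n
  rw [← inner_conj_symm _ (b n), inner_expGroup, inner_expGroup, map_mul, inner_conj_symm]
  have : (starRingEnd ℂ) (Complex.exp ((t * μ n : ℝ) * Complex.I))
      * Complex.exp ((t * μ n : ℝ) * Complex.I) = 1 := by
    rw [← Complex.normSq_eq_conj_mul_self, Complex.normSq_eq_norm_sq,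
      Complex.norm_exp_ofReal_mul_I]
    simp
  linear_combination ⟪f, b n⟫_ℂ * ⟪b n, g⟫_ℂ * this

lemma continuous_expGroup_apply (f : H) : Continuous fun t => expGroup b μ t f := by
  rw [continuous_iff_continuousAt]
  intro t
  rw [ContinuousAt, tendsto_iff_norm_sub_tendsto_zero]
  have key : Filter.Tendsto (fun τ => ‖expGroup b μ τ f - expGroup b μ t f‖ ^ 2) (nhds t)
      (nhds 0) := by
    have e : ∀ τ, ‖expGroup b μ τ f - expGroup b μ t f‖ ^ 2
        = ∑' n, ‖Complex.exp ((τ * μ n : ℝ) * Complex.I)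
            - Complex.exp ((t * μ n : ℝ) * Complex.I)‖ ^ 2 * ‖⟪b n, f⟫_ℂ‖ ^ 2 := fun τ => by
      rw [← (hasSum_norm_inner_sq b _).tsum_eq]
      congr 1; ext n
      rw [inner_sub_right, inner_expGroup, inner_expGroup, ← sub_mul, norm_mul, mul_pow]
    simp_rw [e]
    -- Each coefficient tends to zero, and `4 = 2²` dominates since two unimodular numbers differ by
    -- at most `2`.
    have := tendsto_tsum_of_dominated_convergence (𝓕 := nhds t)
      (f := fun τ n => ‖Complex.exp ((τ * μ n : ℝ) * Complex.I)
            - Complex.exp ((t * μ n : ℝ) * Complex.I)‖ ^ 2 * ‖⟪b n, f⟫_ℂ‖ ^ 2) (g := fun _ => 0)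
      (bound := fun n => 4 * ‖⟪b n, f⟫_ℂ‖ ^ 2)
      ((hasSum_norm_inner_sq b f).summable.mul_left 4) (fun n => ?_)
      (Filter.Eventually.of_forall fun τ n => ?_)
    · simpa using this
    · have hc : Continuous fun τ : ℝ => ‖Complex.exp ((τ * μ n : ℝ) * Complex.I)
            - Complex.exp ((t * μ n : ℝ) * Complex.I)‖ ^ 2 * ‖⟪b n, f⟫_ℂ‖ ^ 2 := by fun_prop
      simpa using hc.tendsto t
    · rw [Real.norm_of_nonneg (by positivity)]
      gcongr
      have : ‖Complex.exp ((τ * μ n : ℝ) * Complex.I)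
            - Complex.exp ((t * μ n : ℝ) * Complex.I)‖ ≤ 2 := by
        refine (norm_sub_le _ _).trans ?_
        rw [Complex.norm_exp_ofReal_mul_I, Complex.norm_exp_ofReal_mul_I]; norm_num
      nlinarith [norm_nonneg (Complex.exp ((τ * μ n : ℝ) * Complex.I)
            - Complex.exp ((t * μ n : ℝ) * Complex.I))]
  have := key.sqrt
  simpa [Real.sqrt_sq (norm_nonneg _)] using this

lemma continuousOn_expGroup_apply {σ : ℝ → ℝ} (hσ : Continuous σ) {g : ℝ → H} {S : Set ℝ}
    (hg : ContinuousOn g S) : ContinuousOn (fun t => expGroup b μ (σ t) (g t)) S :=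
  continuousOn_apply_of_strong (fun t x => expGroup b μ (σ t) x) 1
    (fun t x y => by rw [← map_sub, norm_expGroup_apply, one_mul])
    (fun x => (continuous_expGroup_apply b μ x).comp hσ) hg

/-- A curve whose coefficients are differentiable is differentiable, if the derivatives are the
coefficients of a continuous curve. -/
lemma hasDerivWithinAt_of_coeff [CompleteSpace H] {T : ℝ} (hT' : 0 < T) {w g : ℝ → H}
    (hg : ContinuousOn g (Icc 0 T))
    (h : ∀ n, ∀ t ∈ Icc 0 T,
      HasDerivWithinAt (fun τ => ⟪b n, w τ⟫_ℂ) ⟪b n, g t⟫_ℂ (Icc 0 T) t)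
    {t : ℝ} (ht : t ∈ Icc 0 T) : HasDerivWithinAt w (g t) (Icc 0 T) t := by
  have hT : 0 ≤ T := hT'.le
  have h0 : (0 : ℝ) ∈ Icc 0 T := ⟨le_rfl, hT⟩
  set g' : ℝ → H := IccExtend hT ((Icc 0 T).domRestrict g) with hg'
  have hg'c : Continuous g' := hg.domRestrict.Icc_extend'
  have hg'e : ∀ t ∈ Icc 0 T, g' t = g t := fun t ht => by
    rw [hg', IccExtend_of_mem hT _ ht]; rfl
  set W : ℝ → H := fun t => w 0 + ∫ τ in (0 : ℝ)..t, g' τ with hW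
  -- `W` is the primitive of the continuous extension of `g`. It has the same coefficients as `w` on
  -- `[0,T]`, so `w` inherits its differentiability in norm.
  have hWd : ∀ t, HasDerivAt W (g' t) t := fun t =>
    (intervalIntegral.integral_hasDerivAt_right (hg'c.intervalIntegrable _ _)
      (hg'c.stronglyMeasurableAtFilter _ _) hg'c.continuousAt).const_add _
  have hEq : ∀ t ∈ Icc 0 T, w t = W t := fun t ht => basis_ext (b := b) fun n => by
    have hd : ∀ t ∈ Icc 0 T, HasDerivWithinAt (fun τ => ⟪b n, w τ⟫_ℂ - ⟪b n, W τ⟫_ℂ) 0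
        (Icc 0 T) t := fun t ht => by
      have h1 := (h n t ht).sub
        (((innerSL ℂ (b n)).hasFDerivAt.restrictScalars ℝ).comp_hasDerivAt t
          (hWd t)).hasDerivWithinAt
      refine h1.congr_deriv ?_
      simp [hg'e t ht]
    have hc := (convex_Icc (0 : ℝ) T).is_const_of_fderivWithin_eq_zero (𝕜 := ℝ)
      (f := fun τ => ⟪b n, w τ⟫_ℂ - ⟪b n, W τ⟫_ℂ)
      (fun t ht => (hd t ht).differentiableWithinAt) (fun t ht => by
        have := (hd t ht).hasFDerivWithinAt.fderivWithin (uniqueDiffOn_Icc hT' t ht)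
        rw [this]; ext; simp) ht h0
    simp only [hW, intervalIntegral.integral_same, add_zero, sub_self] at hc
    exact sub_eq_zero.1 hc
  exact ((hg'e t ht) ▸ (hWd t).hasDerivWithinAt).congr hEq (hEq t ht)

end Diagonal

/-! ### The abstract damped wave equation. -/

section Wave

variable {ι H : Type*} [NormedAddCommGroup H] [InnerProductSpace ℂ H]

/-- `u` solves `u'' + A² u + P u + Q u' = 0` coefficientwise, where `A` is diagonal in the basis `b`
with eigenvalues `μ`, `w = A u` and `z = u'`. -/
structure IsModalSolution (b : HilbertBasis ι ℂ H) (μ : ι → ℝ) (P Q : H →L[ℂ] H) (T : ℝ)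
    (u w z : ℝ → H) : Prop where
  coeff : ∀ t ∈ Icc 0 T, ∀ n, ⟪b n, w t⟫_ℂ = μ n * ⟪b n, u t⟫_ℂ
  continuousOn_left : ContinuousOn w (Icc 0 T)
  continuousOn_right : ContinuousOn z (Icc 0 T)
  hasDeriv : ∀ t ∈ Icc 0 T, HasDerivWithinAt u (z t) (Icc 0 T) t
  equation : ∀ n, ∀ t ∈ Icc 0 T, HasDerivWithinAt (fun τ => ⟪b n, z τ⟫_ℂ)
    (-(μ n * ⟪b n, w t⟫_ℂ + ⟪b n, P (u t)⟫_ℂ + ⟪b n, Q (z t)⟫_ℂ)) (Icc 0 T) t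

variable {b : HilbertBasis ι ℂ H} {μ : ι → ℝ} {P Q : H →L[ℂ] H} {T : ℝ} {u w z : ℝ → H}

lemma hasDerivWithinAt_of_eq {E : Type*} [NormedAddCommGroup E] [NormedSpace ℝ E] {f g : ℝ → E}
    {f' g' : E} {S : Set ℝ} {t : ℝ} (h : HasDerivWithinAt f f' S t) (hf : ∀ τ, g τ = f τ)
    (hf' : g' = f') : HasDerivWithinAt g g' S t :=
  (funext hf : g = f) ▸ hf' ▸ h

lemma hasDerivAt_exp_mul_I (c : ℝ) (t : ℝ) :
    HasDerivAt (fun τ : ℝ => Complex.exp ((τ * c : ℝ) * Complex.I))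
      (c * Complex.I * Complex.exp ((t * c : ℝ) * Complex.I)) t := by
  have h1 : HasDerivAt (fun τ : ℝ => ((τ * c : ℝ) : ℂ) * Complex.I) (c * Complex.I) t := by
    have := (((hasDerivAt_id t).mul_const c).ofReal_comp).mul_const Complex.I
    simpa using this
  simpa [mul_comm] using h1.cexp

/-- The group is differentiable along vectors `v` of the domain of `A`, with `v' = Av`. -/
lemma hasDerivWithinAt_expGroup_apply [CompleteSpace H] (hT : 0 < T) (ε : ℝ) {v v' : H}
    (hv : ∀ n, ⟪b n, v'⟫_ℂ = μ n * ⟪b n, v⟫_ℂ) {t : ℝ} (ht : t ∈ Icc 0 T) :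
    HasDerivWithinAt (fun τ => expGroup b μ (ε * τ) v)
      (expGroup b μ (ε * t) ((ε * Complex.I : ℂ) • v')) (Icc 0 T) t := by
  refine hasDerivWithinAt_of_coeff b hT
    (g := fun t => expGroup b μ (ε * t) ((ε * Complex.I : ℂ) • v'))
    (continuousOn_expGroup_apply b μ (by fun_prop) continuousOn_const) (fun n t _ => ?_) ht
  simp only [inner_expGroup, inner_smul_right, hv]
  have := ((hasDerivAt_exp_mul_I (ε * μ n) t).mul_const ⟪b n, v⟫_ℂ).hasDerivWithinAt
    (s := Icc 0 T)
  refine hasDerivWithinAt_of_eq this (fun τ => ?_) ?_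
  · congr 4; ring
  · rw [show t * (ε * μ n) = ε * t * μ n by ring]
    push_cast; ring

namespace IsModalSolution

lemma continuousOn (h : IsModalSolution b μ P Q T u w z) : ContinuousOn u (Icc 0 T) :=
  fun t ht => (h.hasDeriv t ht).continuousWithinAt

/-- In each coefficient the terms with `μ n` cancel because `ε² = 1` and `i² = -1`. What remains is
continuous in norm, so the profile is differentiable in norm although `z` and `w` need not be. -/
lemma hasDerivWithinAt_profile [CompleteSpace H] (hT : 0 < T)
    (h : IsModalSolution b μ P Q T u w z) {ε : ℝ} (hε : ε ^ 2 = 1) {t : ℝ} (ht : t ∈ Icc 0 T) :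
    HasDerivWithinAt (fun τ => expGroup b μ (-ε * τ) (z τ + (ε * Complex.I : ℂ) • w τ))
      (expGroup b μ (-ε * t) (-(P (u t) + Q (z t)))) (Icc 0 T) t := by
  refine hasDerivWithinAt_of_coeff b hT
    (g := fun t => expGroup b μ (-ε * t) (-(P (u t) + Q (z t))))
    (continuousOn_expGroup_apply b μ (by fun_prop) ?_) (fun n t ht => ?_) ht
  · exact ((P.continuous.comp_continuousOn h.continuousOn).add
      (Q.continuous.comp_continuousOn h.continuousOn_right)).neg
  · simp only [inner_expGroup, inner_add_right, inner_neg_right, inner_smul_right]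
    have hw : HasDerivWithinAt (fun τ => ⟪b n, w τ⟫_ℂ) (μ n * ⟪b n, z t⟫_ℂ) (Icc 0 T) t := by
      have h1 := (((innerSL ℂ (b n)).hasFDerivAt.restrictScalars ℝ).comp_hasDerivWithinAt t
        (h.hasDeriv t ht)).const_mul (μ n : ℂ)
      exact h1.congr (fun τ hτ => h.coeff τ hτ n) (h.coeff t ht n)
    have h1 := (hasDerivAt_exp_mul_I (-ε * μ n) t).hasDerivWithinAt (s := Icc 0 T)
    have h2 := h1.mul ((h.equation n t ht).add (hw.const_mul (ε * Complex.I)))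
    refine hasDerivWithinAt_of_eq h2 (fun τ => ?_) ?_
    · simp only [Pi.mul_apply, Pi.add_apply]; congr 4; ring
    · simp only [Pi.add_apply]
      rw [show t * (-ε * μ n) = -ε * t * μ n by ring]
      have hε' : (ε : ℂ) ^ 2 = 1 := by exact_mod_cast hε
      push_cast
      linear_combination (μ n * ⟪b n, w t⟫_ℂ * Complex.exp (-ε * t * μ n * Complex.I)) *
        (Complex.I ^ 2 * hε' + Complex.I_sq)

/-- The weak equation, tested with an arbitrary element of the domain of `A`. -/
lemma hasDerivWithinAt_inner [CompleteSpace H] (hT : 0 < T)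
    (h : IsModalSolution b μ P Q T u w z) {v v' : H}
    (hv : ∀ n, ⟪b n, v'⟫_ℂ = μ n * ⟪b n, v⟫_ℂ) {t : ℝ} (ht : t ∈ Icc 0 T) :
    HasDerivWithinAt (fun τ => ⟪v, z τ⟫_ℂ)
      (-(⟪v', w t⟫_ℂ + ⟪v, P (u t)⟫_ℂ + ⟪v, Q (z t)⟫_ℂ)) (Icc 0 T) t := by
  -- By unitarity `⟨v, z + iεw⟩` is the inner product of `e^{-iεtA}v` with the profile, and both
  -- factors are differentiable. Averaging over `ε = ±1` eliminates `w` on the left.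
  have key : ∀ ε : ℝ, ε ^ 2 = 1 →
      HasDerivWithinAt (fun τ => ⟪v, z τ + (ε * Complex.I : ℂ) • w τ⟫_ℂ)
        (ε * Complex.I * ⟪v', z t + (ε * Complex.I : ℂ) • w t⟫_ℂ
          + ⟪v, -(P (u t) + Q (z t))⟫_ℂ) (Icc 0 T) t := fun ε hε => by
    have h1 := (hasDerivWithinAt_expGroup_apply hT (-ε) hv ht).inner ℂ
      (h.hasDerivWithinAt_profile hT hε ht)
    simp only [inner_expGroup_left] at h1
    refine h1.congr_deriv ?_
    rw [inner_smul_left, map_mul, Complex.conj_I, Complex.conj_ofReal]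
    push_cast
    ring
  have h1 := ((key 1 (by norm_num)).add (key (-1) (by norm_num))).const_mul (1 / 2 : ℂ)
  refine hasDerivWithinAt_of_eq h1 (fun τ => ?_) ?_
  · simp only [Pi.add_apply, inner_add_right, inner_smul_right]
    push_cast; ring
  · simp only [inner_add_right, inner_smul_right, inner_neg_right]
    push_cast
    linear_combination (-⟪v', w t⟫_ℂ) * Complex.I_sq

/-- The energy inequality. -/
theorem energy_le [CompleteSpace H] (hT : 0 < T) (h : IsModalSolution b μ P Q T u w z)
    (hP : ∀ x y, ⟪P x, y⟫_ℂ = ⟪x, P y⟫_ℂ) (hQ : ∀ x, 0 ≤ RCLike.re ⟪x, Q x⟫_ℂ)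
    {t : ℝ} (ht : t ∈ Icc 0 T) :
    ‖z t‖ ^ 2 + ‖w t‖ ^ 2 + RCLike.re ⟪u t, P (u t)⟫_ℂ
      ≤ ‖z 0‖ ^ 2 + ‖w 0‖ ^ 2 + RCLike.re ⟪u 0, P (u 0)⟫_ℂ := by
  set Y : ℝ → ℝ → H := fun ε τ => expGroup b μ (-ε * τ) (z τ + (ε * Complex.I : ℂ) • w τ) with hY
  set G : ℝ → ℂ := fun τ => (1 / 2 : ℂ) * (⟪Y 1 τ, Y 1 τ⟫_ℂ + ⟪Y (-1) τ, Y (-1) τ⟫_ℂ)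
    + ⟪u τ, P (u τ)⟫_ℂ with hG
  have hGe : ∀ τ, (G τ).re = ‖z τ‖ ^ 2 + ‖w τ‖ ^ 2 + RCLike.re ⟪u τ, P (u τ)⟫_ℂ := fun τ => by
    have h1 : G τ = ⟪z τ, z τ⟫_ℂ + ⟪w τ, w τ⟫_ℂ + ⟪u τ, P (u τ)⟫_ℂ := by
      simp only [hG, hY, inner_expGroup_left, inner_add_right, inner_add_left, inner_smul_left,
        inner_smul_right]
      simp only [map_mul, Complex.conj_I, Complex.conj_ofReal]
      push_cast
      linear_combination (-⟪w τ, w τ⟫_ℂ) * Complex.I_sq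
    rw [h1, inner_self_eq_norm_sq_to_K, inner_self_eq_norm_sq_to_K]
    simp [← Complex.ofReal_pow]
  -- The profiles contribute `-2 Re⟨Pu + Qz, z⟩` and, by symmetry of `P`, the potential term
  -- contributes `2 Re⟨Pu, z⟩`. The sum is `-2 Re⟨z, Qz⟩ ≤ 0`.
  have hGd : ∀ τ ∈ Icc 0 T, ∃ d : ℂ, HasDerivWithinAt G d (Icc 0 T) τ ∧ d.re ≤ 0 :=
    fun τ hτ => by
    have h1 := h.hasDerivWithinAt_profile hT (ε := 1) (by norm_num) hτ
    have h2 := h.hasDerivWithinAt_profile hT (ε := -1) (by norm_num) hτ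
    have h3 := h.hasDeriv τ hτ
    have h4 := (P.hasFDerivAt.restrictScalars ℝ).comp_hasDerivWithinAt τ h3
    refine ⟨_, (((h1.inner ℂ h1).add (h2.inner ℂ h2)).const_mul (1 / 2 : ℂ)).add
      (h3.inner ℂ h4), ?_⟩
    simp only [inner_expGroup_left, ContinuousLinearMap.coe_restrictScalars']
    have e : ∀ x y : H, (⟪x, y⟫_ℂ).re = (⟪y, x⟫_ℂ).re := fun x y => by
      rw [← inner_conj_symm, Complex.conj_re]
    have e1 := e (u τ) (P (z τ))
    rw [hP] at e1
    have e2 := e (P (u τ)) (z τ)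
    have e3 := e (Q (z τ)) (z τ)
    have e4 := e (P (u τ)) (w τ)
    have e5 := hQ (z τ)
    have e6 := hP (w τ) (u τ)
    simp only [inner_add_right, inner_add_left, inner_smul_left, inner_smul_right,
      inner_neg_left, inner_neg_right]
    simp at e5 ⊢
    linarith
  have hanti : AntitoneOn (fun τ => (G τ).re) (Icc 0 T) := by
    refine antitoneOn_of_deriv_nonpos (convex_Icc 0 T) (fun τ hτ => ?_) (fun τ hτ => ?_)
      (fun τ hτ => ?_)
    · obtain ⟨d, hd, -⟩ := hGd τ hτ
      exact Complex.continuous_re.continuousAt.comp_continuousWithinAt hd.continuousWithinAt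
    all_goals
      rw [interior_Icc] at hτ
      obtain ⟨d, hd, hd'⟩ := hGd τ (Ioo_subset_Icc_self hτ)
      have hd2 := (Complex.reCLM.hasFDerivAt.comp_hasDerivAt τ
        (hd.hasDerivAt (Icc_mem_nhds hτ.1 hτ.2)))
    · exact hd2.differentiableAt.differentiableWithinAt
    · have := hd2.deriv
      simp only [Function.comp_def, Complex.reCLM_apply] at this
      rw [this]; exact hd'
  have := hanti ⟨le_rfl, hT.le⟩ ht ht.1
  simpa only [hGe] using this

lemma sub {u' w' z' : ℝ → H} (h : IsModalSolution b μ P Q T u w z)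
    (h' : IsModalSolution b μ P Q T u' w' z') :
    IsModalSolution b μ P Q T (u - u') (w - w') (z - z') where
  coeff t ht n := by
    simp only [Pi.sub_apply, inner_sub_right, h.coeff t ht, h'.coeff t ht]; ring
  continuousOn_left := h.continuousOn_left.sub h'.continuousOn_left
  continuousOn_right := h.continuousOn_right.sub h'.continuousOn_right
  hasDeriv t ht := (h.hasDeriv t ht).sub (h'.hasDeriv t ht)
  equation n t ht := by
    simp only [Pi.sub_apply, inner_sub_right, map_sub]
    refine ((h.equation n t ht).sub (h'.equation n t ht)).congr_deriv ?_
    ring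

end IsModalSolution

/-- The right-hand side of the first-order system satisfied by the profiles of a solution. -/
def profileOp (b : HilbertBasis ι ℂ H) (μ : ι → ℝ) (P Q R : H →L[ℂ] H) (t : ℝ) :
    H × H →L[ℂ] H :=
  -(P ∘L R ∘L ((-Complex.I / 2) • (expGroup b μ t ∘L ContinuousLinearMap.fst ℂ H H
      - expGroup b μ (-t) ∘L ContinuousLinearMap.snd ℂ H H))
    + Q ∘L ((1 / 2 : ℂ) • (expGroup b μ t ∘L ContinuousLinearMap.fst ℂ H H
      + expGroup b μ (-t) ∘L ContinuousLinearMap.snd ℂ H H)))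

/-- The profile system is solved, and `z`, `w` are recovered as the half sum and the half difference
(divided by `i`) of the rotated profiles. The lower bound on `μ` makes `R = A⁻¹` bounded, so that `u
= R w` can be inserted in the right-hand side. -/
theorem exists_isModalSolution [CompleteSpace H] (b : HilbertBasis ι ℂ H) (μ : ι → ℝ)
    (P Q : H →L[ℂ] H) {m : ℝ} (hm : 0 < m) (hμ : ∀ n, m ≤ μ n) (hT : 0 < T) {u₀ w₀ : H} (u₁ : H)
    (h₀ : ∀ n, ⟪b n, w₀⟫_ℂ = μ n * ⟪b n, u₀⟫_ℂ) :
    ∃ u w z : ℝ → H, IsModalSolution b μ P Q T u w z ∧ u 0 = u₀ ∧ z 0 = u₁ := by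
  have hμ0 : ∀ n, 0 < μ n := fun n => hm.trans_le (hμ n)
  have hμc : ∀ n, (μ n : ℂ) ≠ 0 := fun n => by exact_mod_cast (hμ0 n).ne'
  set R : H →L[ℂ] H := diag b (fun n => ((μ n)⁻¹ : ℂ)) m⁻¹ (fun n => by
    rw [norm_inv, Complex.norm_real, Real.norm_of_nonneg (hμ0 n).le]
    exact inv_anti₀ hm (hμ n)) with hR
  set F : ℝ → H × H →L[ℂ] H := profileOp b μ P Q R with hF
  set Φ : ℝ → H × H →L[ℝ] H × H := fun t =>
    ((expGroup b μ (-t) ∘L F t).prod (expGroup b μ t ∘L F t)).restrictScalars ℝ with hΦ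
  have hFK : ∀ t, ‖F t‖ ≤ ‖P‖ * ‖R‖ + ‖Q‖ := fun t => by
    refine ContinuousLinearMap.opNorm_le_bound _ (by positivity) fun y => ?_
    have e0 : ∀ c : ℂ, ‖c‖ = 1 / 2 → ∀ a a' : H, ‖a‖ ≤ ‖y‖ → ‖a'‖ ≤ ‖y‖ →
        ‖c • (a - a')‖ ≤ ‖y‖ ∧ ‖c • (a + a')‖ ≤ ‖y‖ := fun c hc a a' ha ha' => by
      rw [norm_smul, norm_smul, hc]
      have := norm_sub_le a a'
      have := norm_add_le a a'
      constructor <;> linarith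
    have e1 := (e0 (-Complex.I / 2) (by simp) (expGroup b μ t y.1) (expGroup b μ (-t) y.2)
      (by rw [norm_expGroup_apply]; exact norm_fst_le y)
      (by rw [norm_expGroup_apply]; exact norm_snd_le y)).1
    have e2 := (e0 (1 / 2) (by simp) (expGroup b μ t y.1) (expGroup b μ (-t) y.2)
      (by rw [norm_expGroup_apply]; exact norm_fst_le y)
      (by rw [norm_expGroup_apply]; exact norm_snd_le y)).2
    have e3 : F t y = -(P (R ((-Complex.I / 2) • (expGroup b μ t y.1 - expGroup b μ (-t) y.2)))
        + Q ((1 / 2 : ℂ) • (expGroup b μ t y.1 + expGroup b μ (-t) y.2))) := rfl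
    rw [e3, norm_neg, add_mul]
    refine (norm_add_le _ _).trans (add_le_add ?_ ?_)
    · rw [mul_assoc]
      exact (P.le_opNorm _).trans (by gcongr; exact (R.le_opNorm _).trans (by gcongr))
    · exact (Q.le_opNorm _).trans (by gcongr)
  have hFc : ∀ y : ℝ → H × H, ∀ S, ContinuousOn y S → ContinuousOn (fun t => F t (y t)) S :=
    fun y S hy => by
    have c1 := continuousOn_expGroup_apply b μ continuous_id hy.fst
    have c2 := continuousOn_expGroup_apply b μ continuous_neg hy.snd
    exact ((P.continuous.comp_continuousOn (R.continuous.comp_continuousOn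
      ((c1.sub c2).const_smul _))).add (Q.continuous.comp_continuousOn
      ((c1.add c2).const_smul _))).neg
  obtain ⟨Y, hY0, hY⟩ := exists_linear_ode_solution Φ (‖P‖ * ‖R‖ + ‖Q‖)
    (fun t => ContinuousLinearMap.opNorm_le_bound _ (by positivity) fun y => by
      have e1 : Φ t y = (expGroup b μ (-t) (F t y), expGroup b μ t (F t y)) := rfl
      rw [e1, Prod.norm_mk, norm_expGroup_apply, norm_expGroup_apply, max_self]
      exact (F t).le_of_opNorm_le (hFK t) y)
    (fun y => by
      have e := hFc (fun _ => y) univ continuousOn_const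
      exact (continuousOn_univ.1 (continuousOn_expGroup_apply b μ continuous_neg e)).prodMk
        (continuousOn_univ.1 (continuousOn_expGroup_apply b μ continuous_id e)))
    (u₁ + Complex.I • w₀, u₁ - Complex.I • w₀) hT.le
  have hYc : ContinuousOn Y (Icc 0 T) := fun t ht => (hY t ht).continuousAt.continuousWithinAt
  set w : ℝ → H := fun t =>
    (-Complex.I / 2) • (expGroup b μ t (Y t).1 - expGroup b μ (-t) (Y t).2) with hw
  set z : ℝ → H := fun t =>
    (1 / 2 : ℂ) • (expGroup b μ t (Y t).1 + expGroup b μ (-t) (Y t).2) with hz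
  have hFe : ∀ t, F t (Y t) = -(P (R (w t)) + Q (z t)) := fun t => rfl
  have c1 := continuousOn_expGroup_apply b μ continuous_id hYc.fst
  have c2 := continuousOn_expGroup_apply b μ continuous_neg hYc.snd
  have hwc : ContinuousOn w (Icc 0 T) := (c1.sub c2).const_smul _
  have hzc : ContinuousOn z (Icc 0 T) := (c1.add c2).const_smul _
  have hYd : ∀ n, ∀ t ∈ Icc 0 T,
      HasDerivWithinAt (fun τ => ⟪b n, expGroup b μ τ (Y τ).1⟫_ℂ)
        (μ n * Complex.I * ⟪b n, expGroup b μ t (Y t).1⟫_ℂ + ⟪b n, F t (Y t)⟫_ℂ) (Icc 0 T) t ∧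
      HasDerivWithinAt (fun τ => ⟪b n, expGroup b μ (-τ) (Y τ).2⟫_ℂ)
        (-(μ n * Complex.I * ⟪b n, expGroup b μ (-t) (Y t).2⟫_ℂ) + ⟪b n, F t (Y t)⟫_ℂ)
        (Icc 0 T) t := fun n t ht => by
    have d1 : HasDerivAt (fun τ => (Y τ).1) (expGroup b μ (-t) (F t (Y t))) t :=
      ((ContinuousLinearMap.fst ℝ H H).hasFDerivAt).comp_hasDerivAt t (hY t ht)
    have d2 : HasDerivAt (fun τ => (Y τ).2) (expGroup b μ t (F t (Y t))) t :=
      ((ContinuousLinearMap.snd ℝ H H).hasFDerivAt).comp_hasDerivAt t (hY t ht)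
    have d1' := ((innerSL ℂ (b n)).hasFDerivAt.restrictScalars ℝ).comp_hasDerivAt t d1
    have d2' := ((innerSL ℂ (b n)).hasFDerivAt.restrictScalars ℝ).comp_hasDerivAt t d2
    have p1 := (hasDerivAt_exp_mul_I (μ n) t).mul d1'
    have p2 := (hasDerivAt_exp_mul_I (-μ n) t).mul d2'
    have ee : Complex.exp (t * μ n * Complex.I) * Complex.exp (-(t * μ n * Complex.I)) = 1 := by
      rw [← Complex.exp_add]; simp
    constructor
    · refine hasDerivWithinAt_of_eq p1.hasDerivWithinAt (fun τ => ?_) ?_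
      · simp [inner_expGroup]
      · simp [inner_expGroup]
        linear_combination (-⟪b n, F t (Y t)⟫_ℂ) * ee
    · refine hasDerivWithinAt_of_eq p2.hasDerivWithinAt (fun τ => ?_) ?_
      · simp [inner_expGroup]
      · simp [inner_expGroup]
        linear_combination (-⟪b n, F t (Y t)⟫_ℂ) * ee
  have hRw : ∀ n t, ⟪b n, R (w t)⟫_ℂ = (μ n : ℂ)⁻¹ * ⟪b n, w t⟫_ℂ := fun n t => inner_diag b _ _ n
  refine ⟨fun t => R (w t), w, z, ⟨fun t _ n => ?_, hwc, hzc, fun t ht => ?_, fun n t ht => ?_⟩,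
    ?_, ?_⟩
  · rw [hRw, mul_inv_cancel_left₀ (hμc n)]
  · refine hasDerivWithinAt_of_coeff b hT hzc (fun n t ht => ?_) ht
    simp only [hRw]
    obtain ⟨p1, p2⟩ := hYd n t ht
    refine hasDerivWithinAt_of_eq
      (((p1.sub p2).const_mul (-Complex.I / 2)).const_mul ((μ n : ℂ)⁻¹)) (fun τ => ?_) ?_
    · simp [hw]
    · simp only [hz, inner_smul_right, inner_add_right]
      have := hμc n
      field_simp
      linear_combination (μ n * (⟪b n, expGroup b μ t (Y t).1⟫_ℂ
        + ⟪b n, expGroup b μ (-t) (Y t).2⟫_ℂ)) * Complex.I_sq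
  · obtain ⟨p1, p2⟩ := hYd n t ht
    refine hasDerivWithinAt_of_eq ((p1.add p2).const_mul (1 / 2 : ℂ)) (fun τ => ?_) ?_
    · simp [hz, mul_add]
    · rw [hFe]
      simp only [hw, inner_smul_right, inner_sub_right, inner_neg_right, inner_add_right]
      ring
  · refine basis_ext (b := b) fun n => ?_
    simp only [hRw]
    simp only [hw, hY0, neg_zero, expGroup_zero]
    simp only [inner_smul_right, inner_sub_right, inner_add_right, h₀]
    have := hμc n
    field_simp
    linear_combination (-2 * μ n * ⟪b n, u₀⟫_ℂ) * Complex.I_sq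
  · simp only [hz, hY0, neg_zero, expGroup_zero]
    module

end Wave

/-! ### The Volterra operator on `L²(0,1)`. -/

section Volterra

lemma vol_univ : vol univ = 1 := by simp [vol]

instance : IsProbabilityMeasure vol := ⟨vol_univ⟩

lemma vol_eq_restrict_Ioc : vol = volume.restrict (Ioc (0 : ℝ) 1) :=
  Measure.restrict_congr_set Ioo_ae_eq_Ioc

lemma integrable_coe (f : L2) : Integrable f vol := (Lp.memLp f).integrable one_le_two

lemma intervalIntegrable_of_integrable_vol {f : ℝ → ℂ} (hf : Integrable f vol) {x y : ℝ}
    (hx : x ∈ Icc (0 : ℝ) 1) (hy : y ∈ Icc (0 : ℝ) 1) : IntervalIntegrable f volume x y := by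
  have h : IntervalIntegrable f volume 0 1 := by
    rw [intervalIntegrable_iff_integrableOn_Ioc_of_le zero_le_one, IntegrableOn,
      ← vol_eq_restrict_Ioc]
    exact hf
  refine h.mono_set ?_
  rw [uIcc_of_le zero_le_one]
  exact uIcc_subset_Icc hx hy

/-- The primitive of an element of `L²(0,1)`, vanishing at `0`. -/
def prim (f : L2) (x : ℝ) : ℂ := ∫ t in Iic x, f t ∂vol

lemma setIntegral_vol_eq {f : ℝ → ℂ} {x : ℝ} (hx : x ∈ Icc (0 : ℝ) 1) :
    ∫ t in Iic x, f t ∂vol = ∫ t in (0 : ℝ)..x, f t := by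
  rw [vol_eq_restrict_Ioc, Measure.restrict_restrict measurableSet_Iic,
    intervalIntegral.integral_of_le hx.1]
  congr 2
  ext t
  simp only [mem_inter_iff, mem_Iic, mem_Ioc]
  constructor
  · rintro ⟨h1, h2, -⟩; exact ⟨h2, h1⟩
  · rintro ⟨h1, h2⟩; exact ⟨h2, h1, h2.trans hx.2⟩

lemma prim_eq_integral (f : L2) {x : ℝ} (hx : x ∈ Icc (0 : ℝ) 1) :
    prim f x = ∫ t in (0 : ℝ)..x, f t := setIntegral_vol_eq hx

lemma prim_zero_right (f : L2) : prim f 0 = 0 := by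
  rw [prim_eq_integral f ⟨le_rfl, zero_le_one⟩]; simp

lemma norm_setIntegral_le (f : L2) {s : Set ℝ} (hs : MeasurableSet s) :
    ‖∫ t in s, f t ∂vol‖ ≤ √(vol.real s) * ‖f‖ := by
  rw [← L2.inner_indicatorConstLp_one (𝕜 := ℂ) hs (measure_ne_top _ _) f]
  refine (norm_inner_le_norm _ _).trans ?_
  gcongr
  refine (norm_indicatorConstLp_le).trans ?_
  rw [Real.sqrt_eq_rpow]
  simp

lemma prim_sub_prim (f : L2) {x y : ℝ} (h : x ≤ y) :
    prim f y - prim f x = ∫ t in Ioc x y, f t ∂vol := by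
  rw [sub_eq_iff_eq_add', prim, prim, ← Iic_union_Ioc_eq_Iic h]
  exact setIntegral_union (Iic_disjoint_Ioc le_rfl) measurableSet_Ioc
    (integrable_coe f).integrableOn (integrable_coe f).integrableOn

/-- Cauchy–Schwarz against an indicator. This Hölder modulus supplies the equicontinuity in
`isCompactOperator_primBounded`. -/
lemma norm_prim_sub_le (f : L2) (x y : ℝ) : ‖prim f x - prim f y‖ ≤ √|x - y| * ‖f‖ := by
  wlog h : y ≤ x generalizing x y
  · rw [norm_sub_rev, abs_sub_comm]; exact this y x (le_of_not_ge h)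
  rw [prim_sub_prim f h]
  refine (norm_setIntegral_le f measurableSet_Ioc).trans ?_
  gcongr
  rw [abs_of_nonneg (sub_nonneg.2 h)]
  refine ENNReal.toReal_le_of_le_ofReal (sub_nonneg.2 h) ?_
  exact (Measure.restrict_apply_le _ _).trans (by simp)

lemma norm_prim_le (f : L2) (x : ℝ) : ‖prim f x‖ ≤ ‖f‖ := by
  refine (norm_setIntegral_le f measurableSet_Iic).trans ?_
  have : √(vol.real (Iic x)) ≤ 1 := Real.sqrt_le_one.2 measureReal_le_one
  calc _ ≤ 1 * ‖f‖ := by gcongr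
    _ = ‖f‖ := one_mul _

lemma continuous_prim (f : L2) : Continuous (prim f) := by
  rw [continuous_iff_continuousAt]
  intro x
  rw [ContinuousAt, tendsto_iff_norm_sub_tendsto_zero]
  have h : Filter.Tendsto (fun y => √|y - x| * ‖f‖) (nhds x) (nhds 0) := by
    have : Continuous fun y => √|y - x| * ‖f‖ := by fun_prop
    simpa using this.tendsto x
  exact squeeze_zero (fun _ => norm_nonneg _) (fun y => norm_prim_sub_le f y x) h

lemma prim_add (f g : L2) (x : ℝ) : prim (f + g) x = prim f x + prim g x := by
  rw [prim, prim, prim, ← integral_add (integrable_coe f).integrableOn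
    (integrable_coe g).integrableOn]
  exact integral_congr_ae (ae_restrict_of_ae (Lp.coeFn_add f g))

lemma prim_smul (c : ℂ) (f : L2) (x : ℝ) : prim (c • f) x = c * prim f x := by
  rw [prim, prim, ← integral_const_mul]
  exact integral_congr_ae (ae_restrict_of_ae (Lp.coeFn_smul c f))

lemma memLp_comp_projIcc (y : Icc (0 : ℝ) 1 →ᵇ ℂ) :
    MemLp (fun x => y (projIcc 0 1 zero_le_one x)) 2 vol :=
  MemLp.of_bound (y.continuous.comp continuous_projIcc).aestronglyMeasurable ‖y‖
    (Filter.Eventually.of_forall fun _ => y.norm_coe_le_norm _)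

/-- A continuous function on `[0,1]` as an element of `L²(0,1)`. -/
def ofBounded : (Icc (0 : ℝ) 1 →ᵇ ℂ) →L[ℂ] L2 :=
  LinearMap.mkContinuous
    { toFun := fun y => (memLp_comp_projIcc y).toLp
      map_add' := fun _ _ => rfl
      map_smul' := fun _ _ => rfl } 1 fun y => by
    have h := Lp.norm_le_of_ae_bound (f := (memLp_comp_projIcc y).toLp) (norm_nonneg y) (by
      filter_upwards [(memLp_comp_projIcc y).coeFn_toLp] with x hx
      rw [hx]; exact y.norm_coe_le_norm _)
    have hu : measureUnivNNReal vol = 1 := by simp [measureUnivNNReal]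
    rw [hu, NNReal.coe_one, Real.one_rpow] at h
    exact h

lemma coeFn_ofBounded (y : Icc (0 : ℝ) 1 →ᵇ ℂ) :
    ofBounded y =ᵐ[vol] fun x => y (projIcc 0 1 zero_le_one x) :=
  (memLp_comp_projIcc y).coeFn_toLp

/-- The primitive as a continuous function on `[0,1]`. -/
def primBounded : L2 →L[ℂ] (Icc (0 : ℝ) 1 →ᵇ ℂ) :=
  LinearMap.mkContinuous
    { toFun := fun f => BoundedContinuousFunction.mkOfCompact
        ⟨fun x => prim f x, (continuous_prim f).comp continuous_subtype_val⟩
      map_add' := fun f g => by ext x; exact prim_add f g x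
      map_smul' := fun c f => by ext x; exact prim_smul c f x } 1 fun f => by
    rw [one_mul]
    exact (BoundedContinuousFunction.norm_le (norm_nonneg _)).2 fun x => norm_prim_le f x

lemma primBounded_apply (f : L2) (x : Icc (0 : ℝ) 1) : primBounded f x = prim f x := rfl

lemma isCompactOperator_primBounded : IsCompactOperator primBounded := by
  refine (isCompactOperator_iff_isCompact_closure_image_ball
    (primBounded : L2 →ₗ[ℂ] (Icc (0 : ℝ) 1 →ᵇ ℂ)) zero_lt_one).2 ?_
  refine BoundedContinuousFunction.arzela_ascoli (Metric.closedBall 0 1)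
    (isCompact_closedBall _ _) _ ?_ ?_
  · rintro _ x ⟨f, hf, rfl⟩
    rw [mem_closedBall_zero_iff]
    exact (norm_prim_le f x).trans (by simpa using (mem_ball_zero_iff.1 hf).le)
  · refine Metric.equicontinuous_of_continuity_modulus (fun r => √r) ?_ _ ?_
    · simpa using Real.continuous_sqrt.tendsto 0
    · rintro x y ⟨_, ⟨f, hf, rfl⟩⟩
      rw [dist_eq_norm]
      refine (norm_prim_sub_le f x y).trans ?_
      have : ‖f‖ ≤ 1 := (mem_ball_zero_iff.1 hf).le
      calc _ ≤ √|(x : ℝ) - y| * 1 := by gcongr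
        _ = _ := by rw [mul_one]; rfl

/-- The Volterra operator. -/
def volterra : L2 →L[ℂ] L2 := ofBounded ∘L primBounded

lemma ae_mem_Ioo : ∀ᵐ x ∂vol, x ∈ Ioo (0 : ℝ) 1 := ae_restrict_mem measurableSet_Ioo

lemma coeFn_volterra (f : L2) : volterra f =ᵐ[vol] prim f := by
  filter_upwards [coeFn_ofBounded (primBounded f), ae_mem_Ioo] with x hx hx'
  rw [volterra, ContinuousLinearMap.comp_apply, hx, primBounded_apply,
    projIcc_of_mem _ (Ioo_subset_Icc_self hx')]

lemma isCompactOperator_volterra : IsCompactOperator volterra :=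
  isCompactOperator_primBounded.clm_comp ofBounded

/-- The constant function `1`. -/
def oneL2 : L2 := indicatorConstLp 2 MeasurableSet.univ (measure_ne_top _ _) 1

lemma coeFn_oneL2 : oneL2 =ᵐ[vol] fun _ => (1 : ℂ) := by
  have := indicatorConstLp_coeFn (p := 2) (hs := MeasurableSet.univ)
    (hμs := measure_ne_top vol univ) (c := (1 : ℂ))
  filter_upwards [this] with x hx
  rw [oneL2, hx, indicator_of_mem (mem_univ x)]

lemma inner_oneL2 (f : L2) : ⟪oneL2, f⟫_ℂ = prim f 1 := by
  rw [oneL2, L2.inner_indicatorConstLp_one (𝕜 := ℂ) MeasurableSet.univ _ f,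
    prim_eq_integral f ⟨zero_le_one, le_rfl⟩, intervalIntegral.integral_of_le zero_le_one,
    ← vol_eq_restrict_Ioc, Measure.restrict_univ]

lemma norm_oneL2_sq : ⟪oneL2, oneL2⟫_ℂ = 1 := by
  rw [inner_oneL2, prim_eq_integral _ ⟨zero_le_one, le_rfl⟩]
  rw [intervalIntegral.integral_of_le zero_le_one, ← vol_eq_restrict_Ioc,
    integral_congr_ae coeFn_oneL2]
  simp

lemma hasDerivAt_primitive_of_continuous {f : ℝ → ℂ} (hf : Continuous f) (x : ℝ) :
    HasDerivAt (fun x => ∫ t in (0 : ℝ)..x, f t) (f x) x :=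
  intervalIntegral.integral_hasDerivAt_right (hf.intervalIntegrable _ _)
    (hf.stronglyMeasurableAtFilter _ _) hf.continuousAt

lemma prim_congr {f : L2} {g : ℝ → ℂ} (h : f =ᵐ[vol] g) {x : ℝ} (hx : x ∈ Icc (0 : ℝ) 1) :
    prim f x = ∫ t in (0 : ℝ)..x, g t := by
  rw [prim, integral_congr_ae (ae_restrict_of_ae h), setIntegral_vol_eq hx]

lemma inner_eq_integral {f g : L2} {f' g' : ℝ → ℂ} (hf : f =ᵐ[vol] f') (hg : g =ᵐ[vol] g') :
    ⟪f, g⟫_ℂ = ∫ t in (0 : ℝ)..1, g' t * (starRingEnd ℂ) (f' t) := by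
  rw [L2.inner_def, intervalIntegral.integral_of_le zero_le_one, ← vol_eq_restrict_Ioc]
  refine integral_congr_ae ?_
  filter_upwards [hf, hg] with x h1 h2
  rw [h1, h2]; rfl

/-- Integration by parts for primitives. -/
lemma inner_volterra_add (f g : L2) :
    ⟪volterra f, g⟫_ℂ + ⟪f, volterra g⟫_ℂ = ⟪f, oneL2⟫_ℂ * ⟪oneL2, g⟫_ℂ := by
  have hd : DenseRange (BoundedContinuousFunction.toLp (E := ℂ) 2 vol ℂ) :=
    BoundedContinuousFunction.toLp_denseRange ℂ vol ℂ (by simp)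
  -- Both sides are continuous in `f` and `g`, so continuous functions suffice, for which the
  -- primitives are classically differentiable.
  refine hd.induction_on₂ (p := fun f g : L2 => ⟪volterra f, g⟫_ℂ + ⟪f, volterra g⟫_ℂ
    = ⟪f, oneL2⟫_ℂ * ⟪oneL2, g⟫_ℂ) ?_ ?_ f g
  · exact isClosed_eq (by fun_prop) (by fun_prop)
  · intro f g
    have hf : BoundedContinuousFunction.toLp (E := ℂ) 2 vol ℂ f =ᵐ[vol] f :=
      BoundedContinuousFunction.coeFn_toLp _ _ _ _
    have hg : BoundedContinuousFunction.toLp (E := ℂ) 2 vol ℂ g =ᵐ[vol] g :=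
      BoundedContinuousFunction.coeFn_toLp _ _ _ _
    set f₁ : L2 := BoundedContinuousFunction.toLp (E := ℂ) 2 vol ℂ f
    set g₁ : L2 := BoundedContinuousFunction.toLp (E := ℂ) 2 vol ℂ g
    have hV : ∀ (k : L2) (k' : ℝ → ℂ), k =ᵐ[vol] k' →
        volterra k =ᵐ[vol] fun x => ∫ t in (0 : ℝ)..x, k' t := fun k k' hk => by
      filter_upwards [coeFn_volterra k, ae_mem_Ioo] with x hx hx'
      rw [hx, prim_congr hk (Ioo_subset_Icc_self hx')]
    have dF := hasDerivAt_primitive_of_continuous f.continuous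
    have dG := hasDerivAt_primitive_of_continuous g.continuous
    have cF : Continuous fun x => ∫ t in (0 : ℝ)..x, f t :=
      continuous_iff_continuousAt.2 fun x => (dF x).continuousAt
    have cG : Continuous fun x => ∫ t in (0 : ℝ)..x, g t :=
      continuous_iff_continuousAt.2 fun x => (dG x).continuousAt
    have dF' : ∀ x, HasDerivAt (fun x => (starRingEnd ℂ) (∫ t in (0 : ℝ)..x, f t))
        ((starRingEnd ℂ) (f x)) x := fun x =>
      (Complex.conjCLE.toContinuousLinearMap.hasFDerivAt.comp_hasDerivAt x (dF x))
    have key := intervalIntegral.integral_deriv_mul_eq_sub (a := 0) (b := 1)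
      (fun x _ => dF' x) (fun x _ => dG x)
      ((Complex.continuous_conj.comp f.continuous).intervalIntegrable _ _)
      (g.continuous.intervalIntegrable _ _)
    rw [inner_eq_integral (hV f₁ f hf) hg, inner_eq_integral hf (hV g₁ g hg),
      ← intervalIntegral.integral_add (Continuous.intervalIntegrable (by fun_prop) _ _)
        (Continuous.intervalIntegrable (by fun_prop) _ _), ← inner_conj_symm f₁ oneL2,
      inner_oneL2, inner_oneL2, prim_congr hf ⟨zero_le_one, le_rfl⟩,
      prim_congr hg ⟨zero_le_one, le_rfl⟩]
    simp only [intervalIntegral.integral_same, map_zero, zero_mul, sub_zero] at key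
    rw [← key]
    congr 1; ext x; ring

lemma ae_eq_zero_of_prim_eq_zero {f : L2} (h : ∀ x ∈ Icc (0 : ℝ) 1, prim f x = 0) : f = 0 := by
  rw [Lp.eq_zero_iff_ae_eq_zero]
  have hi := intervalIntegrable_of_integrable_vol (integrable_coe f)
    (left_mem_Icc.2 zero_le_one) (right_mem_Icc.2 zero_le_one)
  have h1 := hi.ae_hasDerivAt_integral
  filter_upwards [ae_restrict_of_ae h1, ae_mem_Ioo] with x hx hx'
  rw [uIcc_of_le zero_le_one] at hx
  have h2 := hx (Ioo_subset_Icc_self hx') 0 (left_mem_Icc.2 zero_le_one)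
  have h3 : HasDerivAt (fun x => ∫ t in (0 : ℝ)..x, f t) 0 x := by
    refine (hasDerivAt_const x (0 : ℂ)).congr_of_eventuallyEq ?_
    filter_upwards [Icc_mem_nhds hx'.1 hx'.2] with z hz
    rw [← prim_eq_integral f hz, h z hz]
  exact h2.unique h3

lemma eq_of_ae_eq_of_continuous {y z : ℝ → ℂ} (hy : ContinuousOn y (Icc 0 1))
    (hz : ContinuousOn z (Icc 0 1)) (h : y =ᵐ[vol] z) {x : ℝ} (hx : x ∈ Icc (0 : ℝ) 1) :
    y x = z x := by
  have h1 : EqOn y z (Ioo 0 1) :=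
    Measure.eqOn_Ioo_of_ae_eq volume h (hy.mono Ioo_subset_Icc_self) (hz.mono Ioo_subset_Icc_self)
  have h2 : EqOn y z (Icc 0 1) := h1.of_subset_closure hy hz Ioo_subset_Icc_self
    (by rw [closure_Ioo zero_ne_one])
  exact h2 hx

end Volterra

/-! ### Compact resolvent and eigenbasis of the Sturm–Liouville operator. -/

section Spectral

lemma lpSMul_smul (a : LInf) (c : ℂ) (f : L2) : (a • (c • f) : L2) = c • (a • f : L2) := by
  refine Lp.ext ?_
  filter_upwards [Lp.coeFn_lpSMul (r := 2) a (c • f), Lp.coeFn_lpSMul (r := 2) a f,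
    Lp.coeFn_smul c f, Lp.coeFn_smul c (a • f : L2)] with x h1 h2 h3 h4
  rw [h1, h4, Pi.smul_apply', h3, Pi.smul_apply, Pi.smul_apply, h2, Pi.smul_apply', smul_comm]

/-- Multiplication by a bounded real function. -/
def mulOp (a : LInf) : L2 →L[ℂ] L2 :=
  LinearMap.mkContinuous
    { toFun := fun f => (a • f : L2)
      map_add' := fun f g => Lp.add_smul a f g
      map_smul' := fun c f => lpSMul_smul a c f } ‖a‖ fun f => Lp.norm_smul_le a f

lemma mulOp_apply (a : LInf) (f : L2) : mulOp a f = (a • f : L2) := rfl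

lemma norm_mulOp_apply_le (a : LInf) (f : L2) : ‖mulOp a f‖ ≤ ‖a‖ * ‖f‖ := Lp.norm_smul_le a f

lemma coeFn_mulOp (a : LInf) (f : L2) : mulOp a f =ᵐ[vol] fun x => (a x : ℂ) * f x := by
  filter_upwards [Lp.coeFn_lpSMul (r := 2) a f] with x hx
  rw [mulOp_apply, hx]
  simp

lemma mulOp_symm (a : LInf) (f g : L2) : ⟪mulOp a f, g⟫_ℂ = ⟪f, mulOp a g⟫_ℂ := by
  rw [L2.inner_def, L2.inner_def]
  refine integral_congr_ae ?_
  filter_upwards [coeFn_mulOp a f, coeFn_mulOp a g] with x h1 h2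
  rw [h1, h2]
  simp only [RCLike.inner_apply, map_mul, Complex.conj_ofReal]
  ring

lemma re_inner_mulOp_nonneg {a : LInf} (ha : 0 ≤ a) (f : L2) :
    0 ≤ RCLike.re ⟪f, mulOp a f⟫_ℂ := by
  rw [L2.inner_def]
  have h : ∫ x, ⟪f x, mulOp a f x⟫_ℂ ∂vol = ((∫ x, a x * ‖f x‖ ^ 2 ∂vol : ℝ) : ℂ) := by
    rw [← integral_complex_ofReal]
    refine integral_congr_ae ?_
    filter_upwards [coeFn_mulOp a f] with x h1
    rw [h1]
    simp only [RCLike.inner_apply]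
    rw [mul_assoc, Complex.mul_conj, Complex.normSq_eq_norm_sq]
    push_cast; rfl
  rw [h]
  have h0 : 0 ≤ ∫ x, a x * ‖f x‖ ^ 2 ∂vol := by
    refine integral_nonneg_of_ae ?_
    filter_upwards [(Lp.coeFn_nonneg a).2 ha] with x hx
    exact mul_nonneg hx (by positivity)
  simpa using h0

lemma abs_re_inner_mulOp_le (a : LInf) (f : L2) :
    |RCLike.re ⟪f, mulOp a f⟫_ℂ| ≤ ‖a‖ * ‖f‖ ^ 2 := by
  refine (RCLike.abs_re_le_norm _).trans ((norm_inner_le_norm _ _).trans ?_)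
  calc ‖f‖ * ‖mulOp a f‖ ≤ ‖f‖ * (‖a‖ * ‖f‖) := by gcongr; exact norm_mulOp_apply_le a f
    _ = _ := by ring

/-- Projection onto the orthogonal complement of the constants. -/
def projMean : L2 →L[ℂ] L2 :=
  ContinuousLinearMap.id ℂ L2 - (innerSL ℂ oneL2).smulRight oneL2

lemma projMean_apply (f : L2) : projMean f = f - ⟪oneL2, f⟫_ℂ • oneL2 := rfl

lemma projMean_symm (f g : L2) : ⟪projMean f, g⟫_ℂ = ⟪f, projMean g⟫_ℂ := by
  simp only [projMean_apply, inner_sub_left, inner_sub_right, inner_smul_left, inner_smul_right,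
    inner_conj_symm]
  ring

lemma inner_oneL2_projMean (f : L2) : ⟪oneL2, projMean f⟫_ℂ = 0 := by
  rw [projMean_apply, inner_sub_right, inner_smul_right, norm_oneL2_sq]; ring

lemma projMean_of_inner_eq_zero {f : L2} (h : ⟪oneL2, f⟫_ℂ = 0) : projMean f = f := by
  rw [projMean_apply, h]; simp

lemma projMean_one : projMean oneL2 = 0 := by
  rw [projMean_apply, norm_oneL2_sq]; simp

/-- `S` such that `S S*` inverts the Dirichlet Laplacian. -/
def dirS : L2 →L[ℂ] L2 := volterra ∘L projMean

/-- The adjoint of `dirS`. -/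
def dirSadj : L2 →L[ℂ] L2 := -(projMean ∘L volterra)

lemma dirS_apply (f : L2) : dirS f = volterra (projMean f) := rfl

lemma dirSadj_apply (f : L2) : dirSadj f = -projMean (volterra f) := rfl

/-- Integration by parts; the boundary term vanishes because `projMean f` has mean zero. -/
lemma inner_dirS (f g : L2) : ⟪dirS f, g⟫_ℂ = ⟪f, dirSadj g⟫_ℂ := by
  have h := inner_volterra_add (projMean f) g
  rw [← inner_conj_symm (projMean f) oneL2, inner_oneL2_projMean, map_zero, zero_mul] at h
  rw [dirS_apply, dirSadj_apply, inner_neg_right, ← projMean_symm]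
  exact eq_neg_of_add_eq_zero_left h

lemma inner_dirSadj (f g : L2) : ⟪dirSadj f, g⟫_ℂ = ⟪f, dirS g⟫_ℂ := by
  rw [← inner_conj_symm, ← inner_dirS, inner_conj_symm]

lemma inner_oneL2_dirSadj (f : L2) : ⟪oneL2, dirSadj f⟫_ℂ = 0 := by
  rw [dirSadj_apply, inner_neg_right, inner_oneL2_projMean, neg_zero]

lemma dirS_dirSadj (f : L2) : dirS (dirSadj f) = volterra (dirSadj f) := by
  rw [dirS_apply, projMean_of_inner_eq_zero (inner_oneL2_dirSadj f)]

/-- The continuous representative of `S* f`. -/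
lemma coeFn_dirSadj (f : L2) :
    dirSadj f =ᵐ[vol] fun x => ⟪oneL2, volterra f⟫_ℂ - prim f x := by
  rw [dirSadj_apply, projMean_apply, neg_sub]
  filter_upwards [Lp.coeFn_sub (⟪oneL2, volterra f⟫_ℂ • oneL2) (volterra f),
    Lp.coeFn_smul (⟪oneL2, volterra f⟫_ℂ) oneL2, coeFn_oneL2, coeFn_volterra f] with x h1 h2 h3 h4
  rw [h1, Pi.sub_apply, h2, Pi.smul_apply, h3, h4]
  simp

lemma coeFn_sub_mulOp (q : LInf) (f g : L2) :
    (g - mulOp q f : L2) =ᵐ[vol] fun x => g x - (q x : ℂ) * f x := by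
  filter_upwards [Lp.coeFn_sub g (mulOp q f), coeFn_mulOp q f] with x h1 h2
  rw [h1, Pi.sub_apply, h2]

/-- The Sturm–Liouville relation in integrated form. -/
theorem isOp_iff (q : LInf) (f g : L2) : IsOp q f g ↔ f = dirS (dirSadj (g - mulOp q f)) := by
  set h : L2 := g - mulOp q f with hh
  have hprim : ∀ x ∈ Icc (0 : ℝ) 1,
      (∫ t in (0 : ℝ)..x, ((q t : ℂ) * f t - g t)) = -prim h x := fun x hx => by
    rw [prim_congr (coeFn_sub_mulOp q f g) hx, ← intervalIntegral.integral_neg]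
    congr 1; ext t; ring
  constructor
  · rintro ⟨y, p, hfy, hy0, hy1, hyd, hp⟩
    have hp' : ∀ x ∈ Icc (0 : ℝ) 1, p x = p 0 - prim h x := fun x hx => by
      rw [hp x hx, hprim x hx]; ring
    set P : L2 := p 0 • oneL2 - volterra h with hP
    have hPc : P =ᵐ[vol] fun x => p 0 - prim h x := by
      filter_upwards [Lp.coeFn_sub (p 0 • oneL2) (volterra h), Lp.coeFn_smul (p 0) oneL2,
        coeFn_oneL2, coeFn_volterra h] with x h1 h2 h3 h4
      rw [hP, h1, Pi.sub_apply, h2, Pi.smul_apply, h3, h4]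
      simp
    have hyP : ∀ x ∈ Icc (0 : ℝ) 1, y x = prim P x := fun x hx => by
      have hc : Continuous fun x => p 0 - prim h x := by
        have := continuous_prim h
        fun_prop
      rw [prim_congr hPc hx, intervalIntegral.integral_eq_sub_of_hasDeriv_right_of_le (f := y) hx.1
        (fun t ht => (hyd t ⟨ht.1, ht.2.trans hx.2⟩).continuousWithinAt.mono
          (Icc_subset_Icc_right hx.2))
        (fun t ht => ?_) (hc.intervalIntegrable _ _), hy0, sub_zero]
      have ht' : t ∈ Icc (0 : ℝ) 1 := ⟨ht.1.le, ht.2.le.trans hx.2⟩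
      have := (hyd t ht').hasDerivAt (Icc_mem_nhds ht.1 (ht.2.trans_le hx.2))
      rw [hp' t ht'] at this
      exact this.hasDerivWithinAt
    -- The condition `y 1 = 0` says that the derivative `P` of `y` has mean zero. This fixes the
    -- constant `p 0` and forces `P = dirSadj h`.
    have hP1 : ⟪oneL2, P⟫_ℂ = 0 := by
      rw [inner_oneL2, ← hyP 1 ⟨zero_le_one, le_rfl⟩, hy1]
    have hPS : P = dirSadj h := by
      rw [← projMean_of_inner_eq_zero hP1, hP, map_sub, map_smul, projMean_one, smul_zero,
        zero_sub, dirSadj_apply]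
    rw [dirS_dirSadj, ← hPS]
    refine Lp.ext ?_
    filter_upwards [hfy, coeFn_volterra P, ae_mem_Ioo] with x h1 h2 h3
    rw [h1, h2, hyP x (Ioo_subset_Icc_self h3)]
  · intro hf
    set c : ℂ := ⟪oneL2, volterra h⟫_ℂ
    have hpc : Continuous fun x => c - prim h x := by
      have := continuous_prim h
      fun_prop
    refine ⟨fun x => ∫ t in (0 : ℝ)..x, (c - prim h t), fun x => c - prim h x, ?_, by simp, ?_,
      fun x _ => (hasDerivAt_primitive_of_continuous hpc x).hasDerivWithinAt, fun x hx => ?_⟩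
    · rw [dirS_dirSadj] at hf
      filter_upwards [coeFn_volterra (dirSadj h), ae_mem_Ioo] with x h1 h2
      rw [hf, h1, prim_congr (coeFn_dirSadj h) (Ioo_subset_Icc_self h2)]
    · have := inner_oneL2_dirSadj h
      rw [inner_oneL2, prim_congr (coeFn_dirSadj h) ⟨zero_le_one, le_rfl⟩] at this
      exact this
    · simp only
      rw [hprim x hx, prim_zero_right]; ring

/-- The Sturm–Liouville operator is symmetric. -/
lemma inner_of_isOp {q : LInf} {f g f' g' : L2} (h : IsOp q f g) (h' : IsOp q f' g') :
    ⟪f, g'⟫_ℂ = ⟪g, f'⟫_ℂ := by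
  rw [isOp_iff] at h h'
  have e : ⟪f, g' - mulOp q f'⟫_ℂ = ⟪g - mulOp q f, f'⟫_ℂ := by
    conv_lhs => rw [h, inner_dirS]
    conv_rhs => rw [h', ← inner_dirSadj]
  rw [inner_sub_right, inner_sub_left, mulOp_symm] at e
  exact sub_left_injective e

lemma inner_eigen_eq_zero {q : LInf} {ev ev' : ℝ} {φ φ' : L2} (h : IsEigenpair q ev φ)
    (h' : IsEigenpair q ev' φ') (hne : ev ≠ ev') : ⟪φ, φ'⟫_ℂ = 0 := by
  have e := inner_of_isOp h.2 h'.2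
  rw [inner_smul_left, inner_smul_right, Complex.conj_ofReal] at e
  have : ((ev' : ℂ) - ev) * ⟪φ, φ'⟫_ℂ = 0 := by linear_combination e
  refine (mul_eq_zero.1 this).resolve_left ?_
  exact sub_ne_zero.2 (by exact_mod_cast hne.symm)

/-- `dirSadj f` is a constant minus `prim f`. If it vanishes, evaluation at `0` shows that the
constant is zero, hence so is `prim f`. -/
lemma dirSadj_injective {f : L2} (h : dirSadj f = 0) : f = 0 := by
  have h1 := coeFn_dirSadj f
  rw [h] at h1
  have h2 : (fun _ => (0 : ℂ)) =ᵐ[vol] fun x => ⟪oneL2, volterra f⟫_ℂ - prim f x := by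
    filter_upwards [h1, Lp.coeFn_zero ℂ 2 vol] with x h3 h4
    rw [← h3, h4]; rfl
  have hc : Continuous fun x => ⟪oneL2, volterra f⟫_ℂ - prim f x := by
    have := continuous_prim f
    fun_prop
  have h3 := fun x hx => eq_of_ae_eq_of_continuous continuousOn_const hc.continuousOn h2 (x := x) hx
  have h4 := h3 0 ⟨le_rfl, zero_le_one⟩
  rw [prim_zero_right, sub_zero] at h4
  refine ae_eq_zero_of_prim_eq_zero fun x hx => ?_
  have h5 := h3 x hx
  rw [← h4, zero_sub] at h5
  exact neg_eq_zero.1 h5.symm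

/-- A compact symmetric operator inverting a shift of the Sturm–Liouville operator. -/
theorem exists_resolvent (q : LInf) : ∃ (c : ℝ) (G : L2 →L[ℂ] L2), IsCompactOperator G ∧
    (∀ x y, ⟪G x, y⟫_ℂ = ⟪x, G y⟫_ℂ) ∧ ∀ f g, IsOp q f g ↔ f = G (g + (c : ℂ) • f) := by
  set c : ℝ := ‖q‖
  -- With `c = ‖q‖` the shifted potential `Q` is non-negative. Writing `S` for `dirS`, the equation
  -- `f = S S*(k - Q f)` becomes `(1 + S*QS) p = S*k` with `f = S p`. Positivity of `S*QS` makes `1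
  -- + S*QS` invertible, so `G = S (1 + S*QS)⁻¹ S*`.
  set Q : L2 →L[ℂ] L2 := mulOp q + (c : ℂ) • ContinuousLinearMap.id ℂ L2 with hQ
  have hQa : ∀ f, Q f = mulOp q f + (c : ℂ) • f := fun f => rfl
  have hQs : ∀ x y, ⟪Q x, y⟫_ℂ = ⟪x, Q y⟫_ℂ := fun x y => by
    rw [hQa, hQa, inner_add_left, inner_add_right, mulOp_symm, inner_smul_left, inner_smul_right,
      Complex.conj_ofReal]
  have hQp : ∀ x, 0 ≤ RCLike.re ⟪x, Q x⟫_ℂ := fun x => by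
    have h1 := (abs_le.1 (abs_re_inner_mulOp_le q x)).1
    have h2 : RCLike.re ⟪x, (c : ℂ) • x⟫_ℂ = c * ‖x‖ ^ 2 := by
      rw [inner_smul_right, inner_self_eq_norm_sq_to_K]
      simp [← Complex.ofReal_pow]
    rw [hQa, inner_add_right, map_add, h2]
    linarith
  set A : L2 →L[ℂ] L2 := dirSadj ∘L Q ∘L dirS with hA
  have hAa : ∀ x, A x = dirSadj (Q (dirS x)) := fun x => rfl
  have hApos : (0 : L2 →L[ℂ] L2) ≤ A := by
    rw [ContinuousLinearMap.nonneg_iff_isPositive]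
    refine ⟨fun x y => ?_, fun x => ?_⟩
    · change ⟪dirSadj (Q (dirS x)), y⟫_ℂ = ⟪x, dirSadj (Q (dirS y))⟫_ℂ
      rw [inner_dirSadj, hQs, inner_dirS]
    · change 0 ≤ RCLike.re ⟪dirSadj (Q (dirS x)), x⟫_ℂ
      rw [inner_dirSadj, hQs]
      exact hQp _
  have hunit : IsUnit (1 + A) :=
    CStarAlgebra.isUnit_of_le 1 (le_add_of_nonneg_right hApos)
  obtain ⟨M, hM⟩ := hunit
  set N : L2 →L[ℂ] L2 := ↑M⁻¹ with hN
  have hMN : ∀ x, N x + A (N x) = x := fun x => by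
    have : (M : L2 →L[ℂ] L2) * N = 1 := M.mul_inv
    rw [hM] at this
    exact congrArg (fun T : L2 →L[ℂ] L2 => T x) this
  have hNM : ∀ x, N (x + A x) = x := fun x => by
    have : N * (M : L2 →L[ℂ] L2) = 1 := M.inv_mul
    rw [hM] at this
    exact congrArg (fun T : L2 →L[ℂ] L2 => T x) this
  have hAs : ∀ x y, ⟪A x, y⟫_ℂ = ⟪x, A y⟫_ℂ := fun x y => by
    rw [hAa, hAa, inner_dirSadj, hQs, inner_dirS]
  have hNs : ∀ x y, ⟪N x, y⟫_ℂ = ⟪x, N y⟫_ℂ := fun x y => by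
    conv_lhs => rw [← hMN y]
    conv_rhs => rw [← hMN x]
    rw [inner_add_left, inner_add_right, hAs]
  refine ⟨c, dirS ∘L N ∘L dirSadj, ?_, fun x y => ?_, fun f g => ?_⟩
  · exact (isCompactOperator_volterra.comp_clm projMean).comp_clm (N ∘L dirSadj)
  · change ⟪dirS (N (dirSadj x)), y⟫_ℂ = ⟪x, dirS (N (dirSadj y))⟫_ℂ
    rw [inner_dirS, hNs, inner_dirSadj]
  · rw [isOp_iff]
    change _ ↔ f = dirS (N (dirSadj (g + (c : ℂ) • f)))
    have hk : g - mulOp q f = (g + (c : ℂ) • f) - Q f := by rw [hQa]; abel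
    rw [hk]
    generalize g + (c : ℂ) • f = k
    constructor
    · intro h
      set p := dirSadj (k - Q f) with hp
      have h1 : p + A p = dirSadj k := by
        rw [hAa, ← h, hp, map_sub]; abel
      rw [← h1, hNM]
      exact h
    · intro h
      have h1 := hMN (dirSadj k)
      rw [hAa, ← h] at h1
      have h2 : N (dirSadj k) = dirSadj (k - Q f) := by
        rw [map_sub]; exact eq_sub_of_add_eq h1
      rw [← h2]
      exact h

/-- The eigenfunctions of the Sturm–Liouville operator contain a Hilbert basis. -/
theorem exists_eigenbasis (q : LInf) : ∃ (ι : Type) (b : HilbertBasis ι ℂ L2) (ev : ι → ℝ),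
    ∀ n, IsEigenpair q (ev n) (b n) := by
  obtain ⟨c, G, hG, hGs, hGop⟩ := exists_resolvent q
  have hsym : G.IsSymmetric := hGs
  have hfin : ∀ γ : {γ : ℂ // γ ≠ 0},
      FiniteDimensional ℂ (Module.End.eigenspace (G : L2 →ₗ[ℂ] L2) γ.1) := fun γ =>
    ContinuousLinearMap.finite_dimensional_eigenspace hG γ.1 γ.2
  -- If `G k = 0`, then `k` is the image of `0` under the operator relation, so `S S* k = 0` and `k
  -- = 0`. Hence the eigenspaces with nonzero eigenvalue already span a dense subspace.
  have h0 : Module.End.eigenspace (G : L2 →ₗ[ℂ] L2) 0 = ⊥ := by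
    rw [eq_bot_iff]
    intro k hk
    rw [Module.End.mem_eigenspace_iff, zero_smul] at hk
    have h1 : IsOp q 0 k := (hGop 0 k).2 (by rw [smul_zero, add_zero]; exact hk.symm)
    rw [isOp_iff, map_zero, sub_zero] at h1
    have h2 : ⟪dirSadj k, dirSadj k⟫_ℂ = 0 := by rw [← inner_dirS, ← h1, inner_zero_left]
    exact dirSadj_injective (inner_self_eq_zero.1 h2)
  set v : (Σ γ : {γ : ℂ // γ ≠ 0},
      Fin (Module.finrank ℂ (Module.End.eigenspace (G : L2 →ₗ[ℂ] L2) γ.1))) → L2 :=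
    fun i => (stdOrthonormalBasis ℂ (Module.End.eigenspace (G : L2 →ₗ[ℂ] L2) i.1.1) i.2 : L2)
    with hv
  have hon : Orthonormal ℂ v := by
    have hfam := hsym.orthogonalFamily_eigenspaces.comp
      (Subtype.val_injective (p := fun γ : ℂ => γ ≠ 0))
    exact hfam.orthonormal_sigma_orthonormal
      (v_family := fun γ => stdOrthonormalBasis ℂ (Module.End.eigenspace (G : L2 →ₗ[ℂ] L2) γ.1))
      fun γ => (stdOrthonormalBasis ℂ _).orthonormal
  have hcomp : (Submodule.span ℂ (range v))ᗮ = ⊥ := by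
    rw [eq_bot_iff, ← ContinuousLinearMap.orthogonalComplement_iSup_eigenspaces_eq_bot hG hsym]
    refine Submodule.orthogonal_le (iSup_le fun γ => ?_)
    by_cases hγ : γ = 0
    · subst hγ; rw [h0]; exact bot_le
    · intro x hx
      have := hfin ⟨γ, hγ⟩
      set B := stdOrthonormalBasis ℂ (Module.End.eigenspace (G : L2 →ₗ[ℂ] L2) γ)
      have h1 := congrArg (Submodule.subtype _) (B.sum_repr ⟨x, hx⟩)
      rw [map_sum] at h1
      have h2 : (Submodule.subtype (Module.End.eigenspace (G : L2 →ₗ[ℂ] L2) γ)) ⟨x, hx⟩ = x := rfl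
      rw [← h2, ← h1]
      refine Submodule.sum_mem _ fun i _ => ?_
      rw [map_smul]
      exact Submodule.smul_mem _ _ (Submodule.subset_span ⟨⟨⟨γ, hγ⟩, i⟩, rfl⟩)
  -- An eigenvalue `γ` of `G` corresponds to `γ⁻¹ - c` for `𝓛`. Taking the real part loses nothing,
  -- as `γ` is real by symmetry.
  refine ⟨_, HilbertBasis.mkOfOrthogonalEqBot hon hcomp, fun i => (i.1.1)⁻¹.re - c, fun i => ?_⟩
  rw [HilbertBasis.coe_mkOfOrthogonalEqBot]
  have hmem : v i ∈ Module.End.eigenspace (G : L2 →ₗ[ℂ] L2) i.1.1 := Subtype.mem _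
  have hne : v i ≠ 0 := hon.ne_zero i
  have hreal : (starRingEnd ℂ) i.1.1 = i.1.1 :=
    LinearMap.IsSymmetric.conj_eigenvalue_eq_self hsym
      (Module.End.hasEigenvalue_of_hasEigenvector ⟨hmem, hne⟩)
  rw [Module.End.mem_eigenspace_iff] at hmem
  have hmem' : G (v i) = i.1.1 • v i := hmem
  refine ⟨hne, (hGop _ _).2 ?_⟩
  have hr : (((i.1.1)⁻¹.re : ℝ) : ℂ) = (i.1.1)⁻¹ := by
    rw [← Complex.conj_eq_iff_re, map_inv₀, hreal]
  rw [← add_smul]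
  push_cast
  rw [hr, sub_add_cancel, map_smul, hmem', smul_smul, inv_mul_cancel₀ i.1.2, one_smul]

variable {q : LInf} {ι : Type} {b : HilbertBasis ι ℂ L2} {ev : ι → ℝ}

/-- An arbitrary eigenfunction is orthogonal to all basis vectors with another eigenvalue, so its
expansion only involves a single factor `e ^ r`. This reduces the basis-free definition to
coefficients. -/
lemma isFracPow_iff (hb : ∀ n, IsEigenpair q (ev n) (b n)) (r : ℝ) (f g : L2) :
    IsFracPow q r f g ↔ ∀ n, ⟪b n, g⟫_ℂ = ((ev n ^ r : ℝ) : ℂ) * ⟪b n, f⟫_ℂ := by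
  refine ⟨fun h n => h _ _ (hb n), fun h e φ hφ => ?_⟩
  have h1 := b.hasSum_inner_mul_inner φ g
  have h2 := (b.hasSum_inner_mul_inner φ f).mul_left (((e ^ r : ℝ) : ℂ))
  refine h1.unique ?_
  convert! h2 using 2 with n
  rw [h n]
  by_cases hn : ev n = e
  · rw [hn]; ring
  · rw [inner_eigen_eq_zero hφ (hb n) (Ne.symm hn)]; ring

lemma fracPow_eq (hb : ∀ n, IsEigenpair q (ev n) (b n)) {r : ℝ} {f g : L2}
    (h : ∀ n, ⟪b n, g⟫_ℂ = ((ev n ^ r : ℝ) : ℂ) * ⟪b n, f⟫_ℂ) : fracPow q r f = g := by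
  have hex : ∃ g : L2, IsFracPow q r f g := ⟨g, (isFracPow_iff hb r f g).2 h⟩
  rw [fracPow, dif_pos hex]
  have := (isFracPow_iff hb r f _).1 hex.choose_spec
  exact basis_ext (b := b) fun n => by rw [this, h]

end Spectral

/-! ### Continuous representatives and boundary values for `s > 1/2`. -/

section Embedding

/-- The characteristic function of a half-line. -/
def cutoff (x : ℝ) : LInf := indicatorConstLp ∞ (measurableSet_Iic (a := x)) (measure_ne_top _ _) 1

lemma coeFn_mulOp_cutoff (x : ℝ) (f : L2) :
    mulOp (cutoff x) f =ᵐ[vol] (Iic x).indicator f := by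
  have h := indicatorConstLp_coeFn (p := ∞) (hs := measurableSet_Iic (a := x))
    (hμs := measure_ne_top vol _) (c := (1 : ℝ))
  filter_upwards [h, coeFn_mulOp (cutoff x) f] with z h1 h2
  rw [h2, cutoff, h1]
  by_cases hz : z ∈ Iic x <;> simp [hz]

lemma norm_mulOp_cutoff_le (x : ℝ) (f : L2) : ‖mulOp (cutoff x) f‖ ≤ ‖f‖ := by
  refine Lp.norm_le_norm_of_ae_le ?_
  filter_upwards [coeFn_mulOp_cutoff x f] with z hz
  rw [hz]
  exact norm_indicator_le_norm_self _ _

lemma prim_mulOp_cutoff (f : L2) (x z : ℝ) :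
    prim (mulOp (cutoff x) f) z = prim f (min z x) := by
  rw [prim, integral_congr_ae (ae_restrict_of_ae (coeFn_mulOp_cutoff x f)),
    setIntegral_indicator measurableSet_Iic, Iic_inter_Iic]
  rfl

/-- This is `|y(x)|² ≤ 2 ‖y‖ ‖y'‖` for `y(0) = 0`. Cutting `p` off beyond `x` turns the value at `x`
into a mean, and `inner_volterra_add` then applies; to the left of `x` the primitive is unaffected
by the cutoff. -/
lemma norm_prim_sq_le (p : L2) {x : ℝ} (hx : x ≤ 1) :
    ‖prim p x‖ ^ 2 ≤ 2 * ‖volterra p‖ * ‖p‖ := by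
  set p' := mulOp (cutoff x) p with hp'
  have h1 : prim p' 1 = prim p x := by rw [hp', prim_mulOp_cutoff, min_eq_right hx]
  have h2 : mulOp (cutoff x) (volterra p') = mulOp (cutoff x) (volterra p) := by
    refine Lp.ext ?_
    filter_upwards [coeFn_mulOp_cutoff x (volterra p'), coeFn_mulOp_cutoff x (volterra p),
      coeFn_volterra p, coeFn_volterra p'] with z e1 e2 e3 e4
    rw [e1, e2]
    by_cases hz : z ∈ Iic x
    · rw [indicator_of_mem hz, indicator_of_mem hz, e3, e4, hp', prim_mulOp_cutoff,
        min_eq_left hz]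
    · rw [indicator_of_notMem hz, indicator_of_notMem hz]
  have h3 : ⟪volterra p', p'⟫_ℂ = ⟪mulOp (cutoff x) (volterra p), p⟫_ℂ := by
    rw [← h2, mulOp_symm]
  have h4 : ‖⟪volterra p', p'⟫_ℂ‖ ≤ ‖volterra p‖ * ‖p‖ := by
    rw [h3]
    refine (norm_inner_le_norm _ _).trans ?_
    gcongr
    exact norm_mulOp_cutoff_le _ _
  have h5 := inner_volterra_add p' p'
  calc ‖prim p x‖ ^ 2 = ‖⟪p', oneL2⟫_ℂ * ⟪oneL2, p'⟫_ℂ‖ := by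
        rw [norm_mul, norm_inner_symm, inner_oneL2, h1, sq]
    _ = ‖⟪volterra p', p'⟫_ℂ + ⟪p', volterra p'⟫_ℂ‖ := by rw [h5]
    _ ≤ ‖⟪volterra p', p'⟫_ℂ‖ + ‖⟪volterra p', p'⟫_ℂ‖ := by
        refine (norm_add_le _ _).trans ?_
        rw [norm_inner_symm p']
    _ ≤ _ := by linarith

lemma norm_primBounded_sq_le (p : L2) : ‖primBounded p‖ ^ 2 ≤ 2 * ‖volterra p‖ * ‖p‖ := by
  have h0 : 0 ≤ 2 * ‖volterra p‖ * ‖p‖ := by positivity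
  have : ‖primBounded p‖ ≤ √(2 * ‖volterra p‖ * ‖p‖) :=
    (BoundedContinuousFunction.norm_le (Real.sqrt_nonneg _)).2 fun x =>
      Real.le_sqrt_of_sq_le (norm_prim_sq_le p x.2.2)
  calc _ ≤ √(2 * ‖volterra p‖ * ‖p‖) ^ 2 := by gcongr
    _ = _ := Real.sq_sqrt h0

/-- The continuous representative of an element of the domain, in terms of its image. -/
def domRep (q : LInf) (f g : L2) : Icc (0 : ℝ) 1 →ᵇ ℂ :=
  primBounded (dirSadj (g - mulOp q f))

lemma ofBounded_domRep {q : LInf} {f g : L2} (h : IsOp q f g) : ofBounded (domRep q f g) = f := by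
  rw [isOp_iff, dirS_dirSadj] at h
  exact h.symm

lemma domRep_zero (q : LInf) (f g : L2) : domRep q f g ⟨0, le_rfl, zero_le_one⟩ = 0 :=
  prim_zero_right _

lemma domRep_one (q : LInf) (f g : L2) : domRep q f g ⟨1, zero_le_one, le_rfl⟩ = 0 := by
  rw [domRep, primBounded_apply, ← inner_oneL2, inner_oneL2_dirSadj]

/-- Here `p` is the derivative of `f`, and `‖p‖² = Re⟨f, g⟩ - Re⟨f, qf⟩` is at most `(m + ‖q‖)
‖f‖²`. The pointwise bound on primitives does the rest. -/
lemma norm_domRep_sq_le {q : LInf} {f g : L2} (h : IsOp q f g) {m : ℝ}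
    (hm : RCLike.re ⟪f, g⟫_ℂ ≤ m * ‖f‖ ^ 2) :
    ‖domRep q f g‖ ^ 2 ≤ 2 * √(m + ‖q‖) * ‖f‖ ^ 2 := by
  rw [isOp_iff] at h
  set p := dirSadj (g - mulOp q f) with hp
  have hV : volterra p = f := by rw [hp, ← dirS_dirSadj]; exact h.symm
  have h1 : ‖p‖ ^ 2 ≤ (m + ‖q‖) * ‖f‖ ^ 2 := by
    have e1 : ⟪p, p⟫_ℂ = ⟪f, g - mulOp q f⟫_ℂ := by
      conv_lhs => rw [hp, ← inner_dirS, ← h]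
    have e2 := congrArg (RCLike.re (K := ℂ)) e1
    rw [inner_self_eq_norm_sq, inner_sub_right, map_sub] at e2
    have e3 := (abs_le.1 (abs_re_inner_mulOp_le q f)).1
    rw [e2]; linarith
  have h2 : ‖p‖ ≤ √(m + ‖q‖) * ‖f‖ := by
    have := Real.sqrt_le_sqrt h1
    rwa [Real.sqrt_sq (norm_nonneg _), Real.sqrt_mul' _ (by positivity),
      Real.sqrt_sq (norm_nonneg _)] at this
  calc ‖domRep q f g‖ ^ 2 ≤ 2 * ‖volterra p‖ * ‖p‖ := norm_primBounded_sq_le p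
    _ ≤ 2 * ‖f‖ * (√(m + ‖q‖) * ‖f‖) := by rw [hV]; gcongr
    _ = _ := by ring

variable {q : LInf} {ι : Type} {b : HilbertBasis ι ℂ L2} {ev : ι → ℝ}

/-- A Bernstein-type inequality: on the span of eigenfunctions with eigenvalues at most `m`, the
quadratic form of `𝓛` is at most `m ‖f‖²`. -/
lemma norm_sum_eigen_sq_le (hb : ∀ n, IsEigenpair q (ev n) (b n)) (c : ι → ℂ) (F : Finset ι)
    {m : ℝ} (hF : ∀ n ∈ F, ev n ≤ m) :
    ‖∑ n ∈ F, c n • domRep q (b n) ((ev n : ℂ) • b n)‖ ^ 2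
      ≤ 2 * √(m + ‖q‖) * ∑ n ∈ F, ‖c n‖ ^ 2 := by
  set f : L2 := ∑ n ∈ F, c n • b n with hf
  set g : L2 := ∑ n ∈ F, c n • (ev n : ℂ) • b n with hg
  have hrep : ∑ n ∈ F, c n • domRep q (b n) ((ev n : ℂ) • b n) = domRep q f g := by
    simp only [domRep, hf, hg, map_sum, map_smul, map_sub, Finset.sum_sub_distrib, smul_sub]
  have hop : IsOp q f g := by
    rw [isOp_iff]
    simp only [hf, hg, map_sum, map_smul, map_sub, ← Finset.sum_sub_distrib, ← smul_sub]
    refine Finset.sum_congr rfl fun n _ => ?_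
    have := (isOp_iff _ _ _).1 (hb n).2
    simp only [map_sub, map_smul] at this
    exact congrArg _ this
  have hnorm : ‖f‖ ^ 2 = ∑ n ∈ F, ‖c n‖ ^ 2 := by
    have h1 := b.orthonormal.inner_sum c c F
    rw [← hf] at h1
    have h2 := congrArg (RCLike.re (K := ℂ)) h1
    rw [inner_self_eq_norm_sq] at h2
    rw [h2, map_sum]
    refine Finset.sum_congr rfl fun n _ => ?_
    rw [← Complex.normSq_eq_conj_mul_self, Complex.normSq_eq_norm_sq]
    exact Complex.ofReal_re _
  have hinner : RCLike.re ⟪f, g⟫_ℂ ≤ m * ‖f‖ ^ 2 := by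
    have h1 := b.orthonormal.inner_sum c (fun n => c n * ev n) F
    have h2 : ∑ n ∈ F, (c n * ev n) • b n = g := by simp only [hg, smul_smul]
    rw [← hf, h2] at h1
    rw [h1, map_sum, hnorm, Finset.mul_sum]
    refine Finset.sum_le_sum fun n hn => ?_
    rw [← mul_assoc, ← Complex.normSq_eq_conj_mul_self, Complex.normSq_eq_norm_sq,
      ← Complex.ofReal_mul, mul_comm]
    simp only [RCLike.re_to_complex, Complex.ofReal_re]
    gcongr
    exact hF n hn
  rw [hrep, ← hnorm]
  exact norm_domRep_sq_le hop hinner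

/-- Finite eigenfunction expansions are controlled uniformly by their `W^s` norm, for `s > 1/2`. -/
lemma exists_norm_sum_eigen_le (hb : ∀ n, IsEigenpair q (ev n) (b n)) {s δ : ℝ} (hs : 1 / 2 < s)
    (hδ : 0 < δ) (hev : ∀ n, δ ≤ ev n) :
    ∃ C : ℝ, 0 ≤ C ∧ ∀ (c d : ι → ℂ), (∀ n, d n = ((ev n ^ (s / 2) : ℝ) : ℂ) * c n) →
      ∀ F : Finset ι, ‖∑ n ∈ F, c n • domRep q (b n) ((ev n : ℂ) • b n)‖
        ≤ C * √(∑ n ∈ F, ‖d n‖ ^ 2) := by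
  have hk : ∀ n, ∃ k : ℕ, (2 : ℝ) ^ k ≤ ev n / δ ∧ ev n / δ < 2 ^ (k + 1) := fun n =>
    exists_nat_pow_near ((one_le_div hδ).2 (hev n)) one_lt_two
  choose k hk1 hk2 using hk
  -- The block with eigenvalues in `[δ 2^j, δ 2^{j+1})` has squared sup norm of order `2^{j/2}` from
  -- the Bernstein bound times `2^{-js}` from the weight, that is `ρ^j`. The sum over blocks
  -- converges since `ρ < 1`, which is the condition `s > 1/2`.
  set ρ : ℝ := (2 : ℝ) ^ (1 / 2 - s) with hρ
  have hρ0 : 0 < ρ := by positivity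
  have hρ1 : ρ < 1 := Real.rpow_lt_one_of_one_lt_of_neg one_lt_two (by linarith)
  have hr1 : √ρ < 1 := by rw [Real.sqrt_lt' one_pos]; simpa using hρ1
  set M : ℝ := 2 * √(2 * δ + ‖q‖) * δ ^ (-s) with hM
  have hM0 : 0 ≤ M := by positivity
  refine ⟨√M * (1 - √ρ)⁻¹, by have := sub_pos.2 hr1; positivity, fun c d hd F => ?_⟩
  set D : ℝ := ∑ n ∈ F, ‖d n‖ ^ 2 with hD
  have hD0 : 0 ≤ D := Finset.sum_nonneg fun _ _ => by positivity
  have hblock : ∀ j : ℕ,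
      ‖∑ n ∈ F with k n = j, c n • domRep q (b n) ((ev n : ℂ) • b n)‖ ≤ √M * √D * √ρ ^ j := by
    intro j
    set A : ℝ := (2 : ℝ) ^ j with hA
    have hA1 : 1 ≤ A := one_le_pow₀ one_le_two
    have h1 := norm_sum_eigen_sq_le hb c (F.filter fun n => k n = j) (m := 2 * δ * A)
      (fun n hn => by
        have hn' := (Finset.mem_filter.1 hn).2
        have := hk2 n
        rw [div_lt_iff₀ hδ, hn', pow_succ] at this
        linarith)
    have h2 : ∑ n ∈ F with k n = j, ‖c n‖ ^ 2 ≤ (δ * A) ^ (-s) * D := by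
      rw [hD, Finset.mul_sum]
      refine (Finset.sum_le_sum (g := fun n => (δ * A) ^ (-s) * ‖d n‖ ^ 2) fun n hn => ?_).trans
        (Finset.sum_le_sum_of_subset_of_nonneg (Finset.filter_subset _ _)
          fun _ _ _ => by positivity)
      have hn' := (Finset.mem_filter.1 hn).2
      have hle : δ * A ≤ ev n := by
        have := hk1 n
        rw [le_div_iff₀ hδ, hn'] at this
        linarith
      have hpos : 0 < δ * A := by positivity
      have hevn : 0 < ev n := hpos.trans_le hle
      rw [hd n, norm_mul, Complex.norm_real, Real.norm_of_nonneg (by positivity), mul_pow,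
        ← Real.rpow_natCast (ev n ^ (s / 2)), ← Real.rpow_mul hevn.le]
      have e1 : s / 2 * ((2 : ℕ) : ℝ) = s := by push_cast; ring
      rw [e1, ← mul_assoc]
      refine le_mul_of_one_le_left (by positivity) ?_
      rw [Real.rpow_neg hpos.le, inv_mul_eq_div, one_le_div (by positivity)]
      exact Real.rpow_le_rpow hpos.le hle (by linarith)
    have h3 : √(2 * δ * A + ‖q‖) ≤ √(2 * δ + ‖q‖) * √A := by
      rw [← Real.sqrt_mul (by positivity)]
      refine Real.sqrt_le_sqrt ?_
      nlinarith [norm_nonneg q]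
    have h4 : √A * A ^ (-s) = ρ ^ j := by
      rw [Real.sqrt_eq_rpow, ← Real.rpow_add (by positivity), hA, hρ, ← Real.rpow_natCast,
        ← Real.rpow_mul zero_le_two, ← Real.rpow_natCast, ← Real.rpow_mul zero_le_two]
      congr 1; ring
    have h5 : ‖∑ n ∈ F with k n = j, c n • domRep q (b n) ((ev n : ℂ) • b n)‖ ^ 2
        ≤ M * D * ρ ^ j := by
      calc _ ≤ _ := h1
        _ ≤ 2 * (√(2 * δ + ‖q‖) * √A) * ((δ * A) ^ (-s) * D) := by gcongr
        _ = M * D * ρ ^ j := by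
          rw [Real.mul_rpow hδ.le (by positivity), ← h4]; ring
    have h6 := Real.sqrt_le_sqrt h5
    rwa [Real.sqrt_sq (norm_nonneg _), Real.sqrt_mul (by positivity), Real.sqrt_mul hM0,
      show √(ρ ^ j) = √ρ ^ j from by
        rw [Real.sqrt_eq_iff_mul_self_eq (by positivity) (by positivity), ← mul_pow,
          Real.mul_self_sqrt hρ0.le]] at h6
  have hsplit : ∑ n ∈ F, c n • domRep q (b n) ((ev n : ℂ) • b n)
      = ∑ j ∈ F.image k, ∑ n ∈ F with k n = j, c n • domRep q (b n) ((ev n : ℂ) • b n) :=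
    (Finset.sum_fiberwise_of_maps_to (fun n hn => Finset.mem_image_of_mem k hn) _).symm
  rw [hsplit]
  calc _ ≤ ∑ j ∈ F.image k, √M * √D * √ρ ^ j :=
        (norm_sum_le _ _).trans (Finset.sum_le_sum fun j _ => hblock j)
    _ = √M * √D * ∑ j ∈ F.image k, √ρ ^ j := (Finset.mul_sum _ _ _).symm
    _ ≤ √M * √D * (1 - √ρ)⁻¹ := by
        gcongr
        rw [← tsum_geometric_of_lt_one (Real.sqrt_nonneg _) hr1]
        exact (summable_geometric_of_lt_one (Real.sqrt_nonneg _) hr1).sum_le_tsum _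
          fun _ _ => by positivity
    _ = _ := by ring

/-- For `s > 1/2`, elements of `W^s` have a continuous representative vanishing at `0` and `1`. -/
theorem exists_continuous_rep (hb : ∀ n, IsEigenpair q (ev n) (b n)) {s δ : ℝ} (hs : 1 / 2 < s)
    (hδ : 0 < δ) (hev : ∀ n, δ ≤ ev n) {f g : L2}
    (hfg : ∀ n, ⟪b n, g⟫_ℂ = ((ev n ^ (s / 2) : ℝ) : ℂ) * ⟪b n, f⟫_ℂ) :
    ∃ y : ℝ → ℂ, ContinuousOn y (Icc 0 1) ∧ y 0 = 0 ∧ y 1 = 0 ∧ f =ᵐ[vol] y := by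
  obtain ⟨C, hC0, hC⟩ := exists_norm_sum_eigen_le hb hs hδ hev
  have hsum : Summable fun n => ⟪b n, f⟫_ℂ • domRep q (b n) ((ev n : ℂ) • b n) := by
    rw [summable_iff_vanishing_norm]
    intro ε hε
    obtain ⟨F₀, hF₀⟩ := summable_iff_vanishing_norm.1 (hasSum_norm_inner_sq b g).summable
      ((ε / (C + 1)) ^ 2) (by positivity)
    refine ⟨F₀, fun F hF => ?_⟩
    have h1 := hF₀ F hF
    rw [Real.norm_of_nonneg (Finset.sum_nonneg fun _ _ => by positivity)] at h1
    have h2 := Real.sqrt_lt_sqrt (Finset.sum_nonneg fun _ _ => by positivity) h1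
    rw [Real.sqrt_sq (by positivity)] at h2
    calc _ ≤ C * √(∑ n ∈ F, ‖⟪b n, g⟫_ℂ‖ ^ 2) := hC _ _ hfg F
      _ ≤ (C + 1) * √(∑ n ∈ F, ‖⟪b n, g⟫_ℂ‖ ^ 2) := by gcongr; linarith
      _ < (C + 1) * (ε / (C + 1)) := by gcongr
      _ = ε := by field_simp
  obtain ⟨Y, hY⟩ := hsum
  -- The uniform limit of the expansion agrees with its `L²` limit, and it inherits the zeros of the
  -- eigenfunctions at both endpoints.
  have hYf : ofBounded Y = f := by
    have h1 := ofBounded.hasSum hY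
    have h2 := b.hasSum_repr f
    refine h1.unique ?_
    convert h2 using 2 with n
    simp only [map_smul, ofBounded_domRep (hb n).2, b.repr_apply_apply]
  have hval : ∀ x : Icc (0 : ℝ) 1, (∀ n, domRep q (b n) ((ev n : ℂ) • b n) x = 0) → Y x = 0 := by
    intro x hx
    have h1 := (BoundedContinuousFunction.evalCLM ℂ x).hasSum hY
    refine h1.unique ?_
    convert hasSum_zero using 2 with n
    change ⟪b n, f⟫_ℂ • domRep q (b n) ((ev n : ℂ) • b n) x = 0
    rw [hx n, smul_zero]
  refine ⟨fun x => Y (projIcc 0 1 zero_le_one x),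
    (Y.continuous.comp continuous_projIcc).continuousOn, ?_, ?_, ?_⟩
  · simp only
    rw [projIcc_left]
    exact hval _ fun n => domRep_zero _ _ _
  · simp only
    rw [projIcc_right]
    exact hval _ fun n => domRep_one _ _ _
  · rw [← hYf]
    exact coeFn_ofBounded Y

end Embedding

/-! ### From modal solutions to solutions and back. -/

section WellPosedness

variable {q : LInf} {ι : Type} {e : HilbertBasis ι ℂ L2} {ev : ι → ℝ}

lemma inner_fracPow (he : ∀ n, IsEigenpair q (ev n) (e n)) {s : ℝ} {f : L2}
    (hf : MemSobolev q s f) (n : ι) :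
    ⟪e n, fracPow q (s / 2) f⟫_ℂ = ((ev n ^ (s / 2) : ℝ) : ℂ) * ⟪e n, f⟫_ℂ := by
  obtain ⟨g, hg⟩ := hf
  have := (isFracPow_iff he _ _ _).1 hg
  rw [fracPow_eq he this, this]

lemma inner_eigen_smul (e : HilbertBasis ι ℂ L2) (μ : ι → ℝ) (m n : ι) :
    ⟪e m, (μ n : ℂ) • e n⟫_ℂ = (μ m : ℂ) * ⟪e m, e n⟫_ℂ := by
  classical
  rw [inner_smul_right, orthonormal_iff_ite.1 e.orthonormal m n]
  by_cases h : m = n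
  · rw [h]
  · rw [if_neg h]; ring

/-- Eigenfunctions are admissible test functions. Every solution is thereby subject to the energy
inequality, which is what uniqueness needs. -/
lemma IsSolution.isModalSolution {T s : ℝ} (hT : 0 < T) {a b : LInf} {u₀ u₁ : L2} {u : ℝ → L2}
    (he : ∀ n, IsEigenpair q (ev n) (e n)) (h : IsSolution T s q a b u₀ u₁ u) :
    IsModalSolution e (fun n => ev n ^ (s / 2)) (mulOp a) (mulOp b) T u
      (fun t => fracPow q (s / 2) (u t)) (timeDeriv T u) where
  coeff t ht n := inner_fracPow he (h.mem_sobolev t ht) n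
  continuousOn_left := h.continuousOn_sobolev
  continuousOn_right := h.contDiffOn.continuousOn_derivWithin (uniqueDiffOn_Icc hT) le_rfl
  hasDeriv t ht := (h.contDiffOn.differentiableOn one_ne_zero t ht).hasDerivWithinAt
  equation n t ht := by
    have hn := inner_eigen_smul e (fun n => ev n ^ (s / 2))
    have hmem : MemSobolev q s (e n) :=
      ⟨((ev n ^ (s / 2) : ℝ) : ℂ) • e n, (isFracPow_iff he _ _ _).2 fun m => hn m n⟩
    have h1 := h.equation (e n) hmem t ht
    rw [fracPow_eq he (fun m => hn m n), inner_smul_left, Complex.conj_ofReal] at h1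
    exact h1

lemma IsModalSolution.isSolution {T s δ : ℝ} (hT : 0 < T) (hδ : 0 < δ) {a b : LInf}
    {u₀ u₁ : L2} {u w z : ℝ → L2} (he : ∀ n, IsEigenpair q (ev n) (e n))
    (hev : 0 < s → ∀ n, δ ≤ ev n)
    (h : IsModalSolution e (fun n => ev n ^ (s / 2)) (mulOp a) (mulOp b) T u w z)
    (h₀ : u 0 = u₀) (h₁ : z 0 = u₁) : IsSolution T s q a b u₀ u₁ u := by
  have hw : ∀ t ∈ Icc 0 T, fracPow q (s / 2) (u t) = w t := fun t ht =>
    fracPow_eq he (h.coeff t ht)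
  have hz : ∀ t ∈ Icc 0 T, timeDeriv T u t = z t := fun t ht =>
    (h.hasDeriv t ht).derivWithin (uniqueDiffOn_Icc hT t ht)
  have h0 : (0 : ℝ) ∈ Icc 0 T := ⟨le_rfl, hT.le⟩
  refine ⟨fun t ht => ⟨w t, (isFracPow_iff he _ _ _).2 (h.coeff t ht)⟩,
    h.continuousOn_left.congr hw, ?_, fun v hv t ht => ?_, h₀, by rw [hz 0 h0, h₁],
    fun hs t ht => ?_⟩
  · rw [show (1 : WithTop ℕ∞) = 0 + 1 from rfl, contDiffOn_succ_iff_derivWithin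
      (uniqueDiffOn_Icc hT)]
    refine ⟨fun t ht => (h.hasDeriv t ht).differentiableWithinAt, by simp, ?_⟩
    rw [contDiffOn_zero]
    exact h.continuousOn_right.congr hz
  · rw [hw t ht, hz t ht]
    refine (h.hasDerivWithinAt_inner hT (inner_fracPow he hv) ht).congr (fun τ hτ => ?_) ?_
    · simp only [hz τ hτ]
    · simp only [hz t ht]
  · exact exists_continuous_rep he hs hδ (hev (by linarith)) (h.coeff t ht)

/-- Here `N`, `N₁` stand for the norms of the data, `A`, `B` for `‖a‖`, `‖b‖`, and `κ N` bounds
`‖u₀‖`. -/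
lemma energy_bound {κ A B N N₁ E : ℝ} (hκ : 0 ≤ κ) (hA : 0 ≤ A) (hB : 0 ≤ B) (hN : 0 ≤ N)
    (hN₁ : 0 ≤ N₁) (hE : E ≤ N₁ ^ 2 + N ^ 2 + A * (κ * N) ^ 2) :
    E ≤ ((1 + κ) * (1 + A + B) * (N + N₁)) ^ 2 := by
  have h1 : 1 + A * κ ^ 2 ≤ ((1 + κ) * (1 + A + B)) ^ 2 := by
    have e1 : (1 + κ) ^ 2 ≥ 1 + κ ^ 2 := by nlinarith
    have e2 : (1 + A + B) ^ 2 ≥ 1 + A := by nlinarith [mul_nonneg hA hB]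
    have e3 : (1 + κ) ^ 2 * (1 + A + B) ^ 2 ≥ (1 + κ ^ 2) * (1 + A) := by gcongr
    rw [mul_pow]
    nlinarith [sq_nonneg κ]
  have h2 : N₁ ^ 2 + N ^ 2 ≤ (N + N₁) ^ 2 := by nlinarith [mul_nonneg hN hN₁]
  have h3 : 0 ≤ A * κ ^ 2 := by positivity
  calc E ≤ N₁ ^ 2 + N ^ 2 + A * (κ * N) ^ 2 := hE
    _ ≤ (1 + A * κ ^ 2) * (N₁ ^ 2 + N ^ 2) := by nlinarith [mul_nonneg h3 (sq_nonneg N₁)]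
    _ ≤ ((1 + κ) * (1 + A + B)) ^ 2 * (N + N₁) ^ 2 := by gcongr
    _ = _ := by ring

end WellPosedness

end SturmLiouville

end

/-! ### The main theorem. -/

theorem mainTheorem2 (T : ℝ) (hT : 0 < T) (s : ℝ) (hs : 0 ≤ s) (δ : ℝ) (hδ : 0 < δ) :
    ∃ C : ℝ, 0 < C ∧
      ∀ q : SturmLiouville.LInf,
        (0 < s → ∀ ev : ℝ, SturmLiouville.IsEigenvalue q ev → δ ≤ ev) →
      ∀ a b : SturmLiouville.LInf, 0 ≤ a → 0 ≤ b →
      ∀ u₀ u₁ : SturmLiouville.L2, SturmLiouville.MemSobolev q s u₀ →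
        ∃ u : ℝ → SturmLiouville.L2,
          SturmLiouville.IsSolution T s q a b u₀ u₁ u ∧
          (∀ v : ℝ → SturmLiouville.L2,
            SturmLiouville.IsSolution T s q a b u₀ u₁ v → Set.EqOn v u (Set.Icc 0 T)) ∧
          ∀ t ∈ Set.Icc 0 T,
            ‖u t‖ ≤ C * (1 + ‖a‖ + ‖b‖) * (SturmLiouville.sobolevNorm q s u₀ + ‖u₁‖) ∧
            ‖SturmLiouville.fracPow q (s / 2) (u t)‖
              ≤ C * (1 + ‖a‖ + ‖b‖) * (SturmLiouville.sobolevNorm q s u₀ + ‖u₁‖) ∧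
            ‖SturmLiouville.timeDeriv T u t‖
              ≤ C * (1 + ‖a‖ + ‖b‖) * (SturmLiouville.sobolevNorm q s u₀ + ‖u₁‖) := by
  open SturmLiouville in
  set m : ℝ := δ ^ (s / 2) with hm
  have hm0 : 0 < m := by positivity
  -- One factor `1 + m⁻¹` comes from `energy_bound` with `κ = m⁻¹`; the other absorbs the loss `‖u‖
  -- ≤ m⁻¹ ‖𝓛^{s/2} u‖`.
  refine ⟨(1 + m⁻¹) ^ 2, by positivity, fun q hq a b ha hb u₀ u₁ hu₀ => ?_⟩
  obtain ⟨ι, e, ev, he⟩ := exists_eigenbasis q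
  have hev : 0 < s → ∀ n, δ ≤ ev n := fun hs n => hq hs _ ⟨_, he n⟩
  have hμ : ∀ n, m ≤ ev n ^ (s / 2) := fun n => by
    rcases hs.eq_or_lt with rfl | hs'
    -- For `s = 0` no sign of the eigenvalues is known, but `x ^ 0 = 1` for every real `x`.
    · simp [hm]
    · exact Real.rpow_le_rpow hδ.le (hev hs' n) (by positivity)
  have hle : ∀ {f g : L2}, (∀ n, inner ℂ (e n) g = ((ev n ^ (s / 2) : ℝ) : ℂ) * inner ℂ (e n) f) →
      ‖f‖ ≤ m⁻¹ * ‖g‖ := fun {f g} h => by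
    refine norm_le_of_coeff_le e (by positivity) fun n => ?_
    have hpos := hm0.trans_le (hμ n)
    rw [h n, norm_mul, Complex.norm_real, Real.norm_of_nonneg hpos.le, ← mul_assoc]
    refine le_mul_of_one_le_left (norm_nonneg _) ?_
    rw [inv_mul_eq_div, one_le_div hm0]
    exact hμ n
  obtain ⟨u, w, z, hmod, h₀, h₁⟩ := exists_isModalSolution e (fun n => ev n ^ (s / 2)) (mulOp a)
    (mulOp b) hm0 hμ hT u₁ (inner_fracPow he hu₀)
  have hsol := hmod.isSolution hT hδ he hev h₀ h₁
  have hM := hsol.isModalSolution hT he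
  have henergy : ∀ {u w z : ℝ → L2},
      IsModalSolution e (fun n => ev n ^ (s / 2)) (mulOp a) (mulOp b) T u w z → ∀ t ∈ Set.Icc 0 T,
      ‖z t‖ ^ 2 + ‖w t‖ ^ 2 ≤ ‖z 0‖ ^ 2 + ‖w 0‖ ^ 2 + ‖a‖ * ‖u 0‖ ^ 2 := fun {u w z} h t ht => by
    have h1 := h.energy_le hT (mulOp_symm a) (re_inner_mulOp_nonneg hb) ht
    have h2 := re_inner_mulOp_nonneg ha (u t)
    have h3 := (abs_le.1 (abs_re_inner_mulOp_le a (u 0))).2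
    linarith
  refine ⟨u, hsol, fun v hv t ht => ?_, fun t ht => ?_⟩
  -- The difference of two solutions has zero initial energy, so its `w` vanishes, and with it the
  -- difference itself, because `μ` is bounded below.
  · have hd := (hv.isModalSolution hT he).sub hM
    have h1 := henergy hd t ht
    simp only [Pi.sub_apply, hv.initial, hsol.initial, hv.initial_deriv, hsol.initial_deriv,
      sub_self, norm_zero] at h1
    have h2 := hle (hd.coeff t ht)
    simp only [Pi.sub_apply] at h2
    have h3 : ‖fracPow q (s / 2) (v t) - fracPow q (s / 2) (u t)‖ = 0 := by
      refine pow_eq_zero_iff two_ne_zero |>.1 (le_antisymm ?_ (by positivity))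
      nlinarith [sq_nonneg ‖timeDeriv T v t - timeDeriv T u t‖]
    rw [h3, mul_zero] at h2
    exact sub_eq_zero.1 (norm_le_zero_iff.1 h2)
  · have h1 := henergy hM t ht
    simp only [hsol.initial, hsol.initial_deriv] at h1
    have h0 := hle (inner_fracPow he hu₀)
    set N := ‖fracPow q (s / 2) u₀‖ with hN
    have hκ : 0 ≤ m⁻¹ := by positivity
    set X := (1 + m⁻¹) * (1 + ‖a‖ + ‖b‖) * (N + ‖u₁‖) with hX
    have hX0 : 0 ≤ X := by positivity
    have h2 := energy_bound hκ (norm_nonneg a) (norm_nonneg b) (norm_nonneg _) (norm_nonneg u₁)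
      (h1.trans (add_le_add_right (mul_le_mul_of_nonneg_left
        (pow_le_pow_left₀ (norm_nonneg _) h0 2) (norm_nonneg a)) _))
    have hz : ‖timeDeriv T u t‖ ≤ X := by
      refine abs_le_of_sq_le_sq' ?_ hX0 |>.2
      linarith [sq_nonneg ‖fracPow q (s / 2) (u t)‖]
    have hw : ‖fracPow q (s / 2) (u t)‖ ≤ X := by
      refine abs_le_of_sq_le_sq' ?_ hX0 |>.2
      linarith [sq_nonneg ‖timeDeriv T u t‖]
    have hu : ‖u t‖ ≤ m⁻¹ * X := (hle (hM.coeff t ht)).trans (by gcongr)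
    have hgoal : (1 + m⁻¹) ^ 2 * (1 + ‖a‖ + ‖b‖) * (sobolevNorm q s u₀ + ‖u₁‖)
        = X + m⁻¹ * X := by
      rw [hX, hN, sobolevNorm]; ring
    rw [hgoal]
    have h3 : 0 ≤ m⁻¹ * X := by positivity
    exact ⟨by linarith, by linarith, by linarith⟩
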